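/- Let $X$ be a complex Banach space. An equivalent norm on $X$ means a complex norm $N$ on $X$ with $a\|x\|\le N(x)\le b\|x\|$ for all $x \in X$ and some constants $a,b>0$; a real isometry of $(X,N)$ is an $\mathbb{R}$-linear bijection $T:X\to X$ with $N(Tx)=N(x)$ for all $x\in X$. (1) If $\dim_{\mathbb C}X\ge 2$, then there is an equivalent norm on $X$ for which the real isometries of $X$ are exactly the maps $\lambda\,\mathrm{Id}$ with $\lambda\in\mathbb{C}$, $|\lambda|=1$. (2) Suppose that the complex structure of $X$ is canonical, i.e. that $X$ is identified, by an $\mathbb{R}$-linear homeomorphism, with the cartesian square $Y\oplus Y$ of a real normed space $Y$ in such a way that multiplication by $i$ on $X$ is given by $i(y,z)=(-z,y)$. Let $c(y,z)=(y,-z)$ be the conjugation map on $X$. Then there is an equivalent norm on $X$ for which the real isometries of $X$ are exactly the maps $\lambda\,\mathrm{Id}$ and $\lambda c$ with $\lambda\in\mathbb{C}$, $|\lambda|=1$. -/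

import Mathlib

/-- `N` is an equivalent (complex) norm on the complex normed space `X`: a complex seminorm which
is bounded above and below by positive multiples of the given norm (in particular `N` is a norm). -/
def IsEquivalentNorm {X : Type*} [NormedAddCommGroup X] [NormedSpace ℂ X]
    (N : Seminorm ℂ X) : Prop :=
  ∃ a b : ℝ, 0 < a ∧ 0 < b ∧ ∀ x : X, a * ‖x‖ ≤ N x ∧ N x ≤ b * ‖x‖

/-- The real-linear bijection `T` of `X` is a real isometry for the norm `N`. -/
def IsRealIsometry {X : Type*} [NormedAddCommGroup X] [NormedSpace ℂ X]
    (N : Seminorm ℂ X) (T : X ≃ₗ[ℝ] X) : Prop :=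
  ∀ x : X, N (T x) = N x

/-- `T = μ Id` for some `μ` in the complex unit circle. -/
def IsTrivialMap {X : Type*} [NormedAddCommGroup X] [NormedSpace ℂ X]
    (T : X ≃ₗ[ℝ] X) : Prop :=
  ∃ μ : ℂ, ‖μ‖ = 1 ∧ ∀ x : X, T x = μ • x

/-- `X` is, as a real topological vector space, the cartesian square `Y ⊕ Y` of a real normed
space `Y`, in such a way that the complex structure of `X` is the canonical one:
`i (y, z) = (-z, y)`. -/
structure CanonicalSquare (X Y : Type*) [NormedAddCommGroup X] [NormedSpace ℂ X]
    [NormedAddCommGroup Y] [NormedSpace ℝ Y] where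
  /-- The real-linear homeomorphism identifying `X` with `Y ⊕ Y`. -/
  equiv : X ≃L[ℝ] Y × Y
  /-- Multiplication by `i` is `(y, z) ↦ (-z, y)`. -/
  equiv_I_smul : ∀ x : X, equiv (Complex.I • x) = (-(equiv x).2, (equiv x).1)

/-- The conjugation map `c (y, z) = (y, -z)` of a canonical complex structure. -/
noncomputable def CanonicalSquare.conj {X Y : Type*} [NormedAddCommGroup X] [NormedSpace ℂ X]
    [NormedAddCommGroup Y] [NormedSpace ℝ Y] (S : CanonicalSquare X Y) (x : X) : X :=
  S.equiv.symm ((S.equiv x).1, -(S.equiv x).2)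

/-- `T = μ c` for some `μ` in the complex unit circle, `c` being the conjugation map. -/
def CanonicalSquare.IsConjugationMap {X Y : Type*} [NormedAddCommGroup X] [NormedSpace ℂ X]
    [NormedAddCommGroup Y] [NormedSpace ℝ Y] (S : CanonicalSquare X Y)
    (T : X ≃ₗ[ℝ] X) : Prop :=
  ∃ μ : ℂ, ‖μ‖ = 1 ∧ ∀ x : X, T x = μ • S.conj x

open Filter Topology

universe u v

/-! The norm is the maximum of a base norm `q`, nowhere locally the modulus of a real-linear map
into `ℂ`, and of the moduli of functionals `φ i` that are uniformly separated up to phases. Each `φ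
i` strictly dominates at its peak, so `N = ‖φ i ·‖` near it. A real isometry `T` turns this into `N
= ‖φ i (T ·)‖` on an open set, and `exists_norm_eq_of_eventually_eq_norm` then gives `j` with `‖φ i
(T ·)‖ = ‖φ j ·‖`: `T` permutes the functionals up to real isometries of `ℂ`.

The functionals are built from a bounded biorthogonal system `(x a, f a)` over a well-ordered set
and a bounded family `h a`. The lopsided edges `3/4 f a + 3/8 f b` encode the order; well-orders are
rigid, so all indices are fixed, and the edges force a single `L` with `f a ∘ T = L ∘ f a`. The
chords `2/3 f a - 2/3 ω f b + h a` do two jobs: `ω = i` excludes conjugate-linear `L` (`map_ω_mul`),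
and two chords from the same `a` yield `h a ∘ T = L ∘ h a` (`h_comp`). Since the `f a` and `h a`
together separate points, `T` is a unimodular multiple of the identity or, when `ω = 1` and the data
are compatible with `c`, possibly of `c`.

In infinite dimension the system comes from transfinite recursion along the least cardinality of a
total set of functionals (`exists_biorthogonal_step`); in finite dimension a basis suffices. For a
canonical square, a system on `Y` is complexified; if `dim Y ≤ 1`, the modulus of one injective
functional works. -/

/-! ### Real-linear maps into `ℂ` and their moduli -/

lemma LinearIsometry.exists_eq_mul (L : ℂ →ₗᵢ[ℝ] ℂ) :
    ∃ μ : ℂ, ‖μ‖ = 1 ∧ ((∀ z, L z = μ * z) ∨ ∀ z, L z = μ * (starRingEnd ℂ) z) := by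
  obtain ⟨a, ha⟩ := linear_isometry_complex (L.toLinearIsometryEquiv rfl)
  refine ⟨a, a.norm_coe, ?_⟩
  rcases ha with ha | ha
  · left
    intro z
    have : L z = _ := DFunLike.congr_fun ha z
    simpa using this
  · right
    intro z
    have : L z = _ := DFunLike.congr_fun ha z
    simpa using this

/-- A real-linear map into `ℂ` with the same modulus as a complex functional is the composition
of the functional with a real-linear isometry of `ℂ`. -/
lemma exists_linearIsometry_of_norm_eq {X : Type*} [AddCommGroup X] [Module ℂ X]
    (φ : X →ₗ[ℂ] ℂ) (g : X →ₗ[ℝ] ℂ) (h : ∀ x, ‖g x‖ = ‖φ x‖) :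
    ∃ L : ℂ →ₗᵢ[ℝ] ℂ, ∀ x, g x = L (φ x) := by
  by_cases h0 : ∀ x, φ x = 0
  · refine ⟨LinearIsometry.id, fun x => ?_⟩
    have := h x
    rw [h0 x, norm_zero, norm_eq_zero] at this
    simp [this, h0 x]
  push Not at h0
  obtain ⟨u₀, hu₀⟩ := h0
  set u : X := (φ u₀)⁻¹ • u₀ with hu
  have hφu : φ u = 1 := by simp [hu, hu₀]
  let e : ℂ →ₗ[ℝ] ℂ := g ∘ₗ ((LinearMap.toSpanSingleton ℂ X u).restrictScalars ℝ)
  have he : ∀ z, e z = g (z • u) := fun z => rfl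
  have hen : ∀ z, ‖e z‖ = ‖z‖ := fun z => by rw [he, h]; simp [hφu]
  refine ⟨⟨e, hen⟩, fun x => ?_⟩
  -- `x - φ x • u` is in the kernel of `φ`, hence in that of `g`; so `g` is determined on the line
  -- through `u`.
  have : ‖g (x - φ x • u)‖ = 0 := by rw [h]; simp [hφu]
  rw [norm_eq_zero, map_sub, sub_eq_zero] at this
  exact this

/-- The modulus of a real-linear map into `ℂ` is determined by its values near one point. -/
lemma norm_eq_of_eventually_norm_eq {X : Type*} [NormedAddCommGroup X] [NormedSpace ℝ X]
    (φ g : X →ₗ[ℝ] ℂ) {x₀ : X} (h : ∀ᶠ x in 𝓝 x₀, ‖g x‖ = ‖φ x‖) (v : X) :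
    ‖g v‖ = ‖φ v‖ := by
  have hc : ∀ s : ℝ, Tendsto (fun t : ℝ => x₀ + (s * t) • v) (𝓝[≠] 0) (𝓝 x₀) := by
    intro s
    have : Continuous (fun t : ℝ => x₀ + (s * t) • v) := by fun_prop
    have h1 := this.tendsto 0
    simp only [mul_zero, zero_smul, add_zero] at h1
    exact h1.mono_left nhdsWithin_le_nhds
  obtain ⟨t, ⟨h1, h2⟩, ht⟩ :=
    (((hc 1).eventually h).and ((hc (-1)).eventually h)).and
      (eventually_mem_nhdsWithin (a := (0 : ℝ)) (s := {0}ᶜ)) |>.exists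
  have h0 := h.self_of_nhds
  simp only [one_mul, neg_mul, neg_smul, ← sub_eq_add_neg, map_add, map_sub, map_smul] at h1 h2
  -- The second difference of the squared modulus at `x₀` in direction `t • v` is `2 t² ‖g v‖²`, so
  -- local values determine `‖g v‖`.
  have p1 := parallelogram_law_with_norm ℝ (g x₀) (t • g v)
  have p2 := parallelogram_law_with_norm ℝ (φ x₀) (t • φ v)
  rw [h1, h2, h0, p2] at p1
  rw [norm_smul, norm_smul] at p1
  have ht' : ‖t‖ ≠ 0 := by simpa using ht
  have : (‖t‖ * ‖φ v‖) * (‖t‖ * ‖φ v‖) = (‖t‖ * ‖g v‖) * (‖t‖ * ‖g v‖) := by linarith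
  have := (mul_self_inj (by positivity) (by positivity)).1 this
  exact (mul_left_cancel₀ ht' this).symm

/-- First-order expansion of the modulus at `r` with a quadratic error. After squaring, `‖w‖ ≤ r /
2` gives `r + 2 Re w ≥ 0`, which absorbs the cross term. -/
lemma norm_add_le_add_re {r : ℝ} (hr : 0 < r) {w : ℂ} (hw : ‖w‖ ≤ r / 2) :
    ‖(r : ℂ) + w‖ ≤ r + w.re + ‖w‖ ^ 2 / r := by
  have hre : -(r / 2) ≤ w.re := by
    have := (abs_le.1 (Complex.abs_re_le_norm w)).1
    linarith
  have hs : 0 ≤ ‖w‖ ^ 2 / r := by positivity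
  apply le_of_sq_le_sq _ (by linarith)
  rw [Complex.sq_norm, Complex.normSq_apply]
  have hwr : ‖w‖ ^ 2 / r * r = ‖w‖ ^ 2 := by field_simp
  have hwn : ‖w‖ ^ 2 = w.re * w.re + w.im * w.im := by
    rw [Complex.sq_norm, Complex.normSq_apply]
  simp only [Complex.add_re, Complex.add_im, Complex.ofReal_re, Complex.ofReal_im, zero_add]
  set s := ‖w‖ ^ 2 / r
  nlinarith [mul_nonneg hs (by linarith : 0 ≤ r + 2 * w.re), mul_self_nonneg w.re, sq_nonneg s]

lemma exists_norm_one_mul_eq_norm (z : ℂ) : ∃ μ : ℂ, ‖μ‖ = 1 ∧ μ * z = ‖z‖ := by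
  by_cases hz : z = 0
  · exact ⟨1, by simp, by simp [hz]⟩
  · have : ‖z‖ ≠ 0 := by simpa using hz
    refine ⟨‖z‖ / z, by simp [this], by field_simp⟩

/-! ### Maxima of separated functionals that are locally a modulus -/

/-- A complex functional which almost attains, at `x₁`, the modulus of a real-linear `g`
dominating it near `x₁` is close to `g` there, up to a phase. -/
lemma abs_re_sub_le_of_norm_le {X : Type*} [NormedAddCommGroup X] [NormedSpace ℂ X]
    {g : X →L[ℝ] ℂ} {x₁ : X} {r : ℝ} (hr : 0 < r) (hg : g x₁ = r) {v : X}
    (hv : ‖g v‖ ≤ r / 2) {ψ : X →L[ℂ] ℂ} {τ : ℝ} (hψ : r - τ ≤ (ψ x₁).re)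
    (h₁ : ‖ψ (x₁ + v)‖ ≤ ‖g (x₁ + v)‖) (h₂ : ‖ψ (x₁ - v)‖ ≤ ‖g (x₁ - v)‖) :
    |(ψ v).re - (g v).re| ≤ τ + ‖g v‖ ^ 2 / r := by
  have e₁ : ‖g (x₁ + v)‖ ≤ r + (g v).re + ‖g v‖ ^ 2 / r := by
    rw [map_add, hg]; exact norm_add_le_add_re hr hv
  have e₂ : ‖g (x₁ - v)‖ ≤ r + (-(g v)).re + ‖-(g v)‖ ^ 2 / r := by
    rw [map_sub, hg, sub_eq_add_neg]; exact norm_add_le_add_re hr (by rwa [norm_neg])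
  have f₁ := (Complex.re_le_norm (ψ (x₁ + v))).trans (h₁.trans e₁)
  have f₂ := (Complex.re_le_norm (ψ (x₁ - v))).trans (h₂.trans e₂)
  rw [map_add, Complex.add_re] at f₁
  rw [map_sub, Complex.sub_re, norm_neg, Complex.neg_re] at f₂
  rw [abs_le]
  constructor <;> linarith

/-- Among the functionals of a norm-separated family which are dominated by a real-linear `g`
near `x₁`, at most one almost attains `‖g x₁‖`. -/
lemma exists_gap_of_separated {X ι : Type*} [NormedAddCommGroup X] [NormedSpace ℂ X]
    (φ : ι → X →L[ℂ] ℂ) {δ : ℝ} (hδ : 0 < δ)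
    (hsep : ∀ i j, i ≠ j → ∀ μ : ℂ, ‖μ‖ = 1 → δ ≤ ‖φ i - μ • φ j‖)
    (g : X →L[ℝ] ℂ) {x₁ : X} (hpos : 0 < ‖g x₁‖)
    (hle : ∀ᶠ x in 𝓝 x₁, ∀ i, ‖φ i x‖ ≤ ‖g x‖) :
    ∃ τ > 0, ∀ i j, ‖g x₁‖ - τ < ‖φ i x₁‖ → ‖g x₁‖ - τ < ‖φ j x₁‖ → i = j := by
  obtain ⟨ν, hν, hνg⟩ := exists_norm_one_mul_eq_norm (g x₁)
  set R : ℝ := ‖g x₁‖ with hR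
  obtain ⟨ρ, hρ, hball⟩ := Metric.eventually_nhds_iff.1 hle
  set K : ℝ := ‖g‖ + 1 with hK
  have hKpos : 0 < K := by positivity
  -- The three bounds keep `x₁ ± v` in the ball of domination, `‖g v‖ ≤ R / 2`, and the quadratic
  -- error at most `δ r / 8`.
  set r : ℝ := min (ρ / 2) (min (R / (2 * K)) (δ * R / (8 * K ^ 2))) with hr
  have hrpos : 0 < r := by positivity
  have hr1 : r < ρ := by
    have := min_le_left (ρ / 2) (min (R / (2 * K)) (δ * R / (8 * K ^ 2)))
    rw [← hr] at this; linarith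
  have hr2 : K * r ≤ R / 2 := by
    have : r ≤ R / (2 * K) := (min_le_right _ _).trans (min_le_left _ _)
    rw [le_div_iff₀ (by positivity)] at this
    linarith
  have hr3 : (K * r) ^ 2 / R ≤ δ * r / 8 := by
    have : r ≤ δ * R / (8 * K ^ 2) := (min_le_right _ _).trans (min_le_right _ _)
    rw [le_div_iff₀ (by positivity)] at this
    rw [div_le_iff₀ hpos]
    nlinarith
  refine ⟨δ * r / 8, by positivity, fun i j hi hj => ?_⟩
  by_contra hij
  let G : X →L[ℝ] ℂ := ν • g
  have hGn : ∀ x, ‖G x‖ = ‖g x‖ := fun x => by simp [G, hν]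
  have hG : G x₁ = (R : ℂ) := by simpa [G] using hνg
  have key : ∀ k, R - δ * r / 8 < ‖φ k x₁‖ → ∃ μ : ℂ, ‖μ‖ = 1 ∧ ∀ v ∈ Metric.sphere (0 : X) r,
      |((μ • φ k) v).re - (G v).re| ≤ δ * r / 4 := by
    intro k hk
    obtain ⟨μ, hμ, hμk⟩ := exists_norm_one_mul_eq_norm (φ k x₁)
    refine ⟨μ, hμ, fun v hv => ?_⟩
    have hv : ‖v‖ = r := by simpa using hv
    have hgv : ‖G v‖ ≤ K * r := by
      rw [hGn]
      calc ‖g v‖ ≤ ‖g‖ * ‖v‖ := g.le_opNorm v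
        _ ≤ K * r := by rw [hv]; gcongr; linarith
    have h1 : ∀ w : X, ‖w‖ = r → ‖(μ • φ k) (x₁ + w)‖ ≤ ‖G (x₁ + w)‖ := by
      intro w hw
      rw [hGn]
      have := hball (y := x₁ + w) (by simp [hw, hr1]) k
      simpa [hμ] using this
    have := abs_re_sub_le_of_norm_le (g := G) (v := v) (ψ := μ • φ k) hpos hG (hgv.trans hr2)
      (τ := δ * r / 8)
      (by
        have : (μ • φ k) x₁ = (‖φ k x₁‖ : ℂ) := by simpa using hμk
        rw [this, Complex.ofReal_re]
        exact hk.le)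
      (h1 v hv) (by simpa [sub_eq_add_neg] using h1 (-v) (by simpa using hv))
    have h3 : ‖G v‖ ^ 2 / R ≤ δ * r / 8 := le_trans (by gcongr) hr3
    linarith
  obtain ⟨μ, hμ, hi'⟩ := key i hi
  obtain ⟨μ', hμ', hj'⟩ := key j hj
  have hsm : ∀ v ∈ Metric.sphere (0 : X) r, ‖(μ • φ i - μ' • φ j) v‖ ≤ δ * r / 2 := by
    intro v hv
    -- Rotating `v` turns the modulus of the difference into a difference of real parts, both within
    -- `δ r / 4` of `Re G`. The difference thus has norm at most `δ / 2`, against separation.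
    obtain ⟨κ, hκ, hκv⟩ := exists_norm_one_mul_eq_norm ((μ • φ i - μ' • φ j) v)
    have hkv : κ • v ∈ Metric.sphere (0 : X) r := by
      simpa [norm_smul, hκ] using hv
    have h1 := abs_le.1 (hi' _ hkv)
    have h2 := abs_le.1 (hj' _ hkv)
    have h3 : ‖(μ • φ i - μ' • φ j) v‖ = ((μ • φ i) (κ • v)).re - ((μ' • φ j) (κ • v)).re := by
      rw [← Complex.sub_re, ← sub_apply, map_smul, smul_eq_mul, hκv,
        Complex.ofReal_re]
    rw [h3]
    linarith
  have hnorm : ‖μ • φ i - μ' • φ j‖ ≤ δ / 2 := by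
    refine ContinuousLinearMap.opNorm_le_bound _ (by positivity) fun v => ?_
    have := LinearMap.bound_of_sphere_bound hrpos (δ * r / 2)
      (μ • φ i - μ' • φ j).toLinearMap hsm v
    calc _ ≤ _ := this
      _ = δ / 2 * ‖v‖ := by field_simp
  have hμ0 : μ ≠ 0 := by rintro rfl; simp at hμ
  have h4 := hsep i j hij (μ⁻¹ * μ') (by simp [hμ, hμ'])
  have h5 : ‖φ i - (μ⁻¹ * μ') • φ j‖ = ‖μ • φ i - μ' • φ j‖ := by
    have : μ • φ i - μ' • φ j = μ • (φ i - (μ⁻¹ * μ') • φ j) := by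
      rw [smul_sub, smul_smul, mul_inv_cancel_left₀ hμ0]
    rw [this, norm_smul, hμ, one_mul]
  linarith

/-- If a maximum of a continuous function `q`, nowhere locally the modulus of a real-linear map,
and of the moduli of a bounded separated family of functionals is locally the modulus of a
real-linear map `g`, then `g` has the modulus of a functional of the family. -/
lemma exists_norm_eq_of_eventually_eq_norm {X ι : Type*} [NormedAddCommGroup X] [NormedSpace ℂ X]
    (φ : ι → X →L[ℂ] ℂ) {C : ℝ} (hC : ∀ i x, ‖φ i x‖ ≤ C * ‖x‖) {δ : ℝ} (hδ : 0 < δ)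
    (hsep : ∀ i j, i ≠ j → ∀ μ : ℂ, ‖μ‖ = 1 → δ ≤ ‖φ i - μ • φ j‖)
    {q N : X → ℝ} (hq : Continuous q) (hq0 : ∀ x, 0 ≤ q x)
    (hN : ∀ x r, N x ≤ r ↔ q x ≤ r ∧ ∀ i, ‖φ i x‖ ≤ r)
    (g : X →L[ℝ] ℂ) (hloc : ∀ x₀, ¬ ∀ᶠ x in 𝓝 x₀, q x = ‖g x‖)
    {x₀ : X} (hg : ∀ᶠ x in 𝓝 x₀, N x = ‖g x‖) :
    ∃ i, ∀ x, ‖g x‖ = ‖φ i x‖ := by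
  have hqN : ∀ x, q x ≤ N x := fun x => ((hN x _).1 le_rfl).1
  have hφN : ∀ x i, ‖φ i x‖ ≤ N x := fun x => ((hN x _).1 le_rfl).2
  -- As `q` is not locally `‖g ·‖`, some nearby point has `q` strictly below `N`; there only the
  -- functionals can account for `N`.
  obtain ⟨x₁, hx₁, hne⟩ : ∃ x₁, (∀ᶠ x in 𝓝 x₁, N x = ‖g x‖) ∧ q x₁ ≠ ‖g x₁‖ := by
    by_contra! hcon
    exact hloc x₀ (hg.eventually_nhds.mono fun x hx => hcon x hx)
  have hlt : q x₁ < ‖g x₁‖ := lt_of_le_of_ne (hx₁.self_of_nhds ▸ hqN x₁) hne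
  have hpos : 0 < ‖g x₁‖ := (hq0 x₁).trans_lt hlt
  obtain ⟨τ, hτ, hgap⟩ := exists_gap_of_separated φ hδ hsep g hpos
    (hx₁.mono fun x hx i => hx ▸ hφN x i)
  obtain ⟨i, hi⟩ : ∃ i, ‖g x₁‖ - τ < ‖φ i x₁‖ := by
    by_contra! hcon
    have := (hN x₁ (max (q x₁) (‖g x₁‖ - τ))).2
      ⟨le_max_left _ _, fun i => (hcon i).trans (le_max_right _ _)⟩
    rw [hx₁.self_of_nhds] at this
    exact absurd this (not_le.2 (max_lt hlt (by linarith)))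
  have hothers : ∀ j, j ≠ i → ‖φ j x₁‖ ≤ ‖g x₁‖ - τ := fun j hj => by
    by_contra! hcon
    exact hj (hgap j i hcon hi)
  have hgc : Continuous fun x => ‖g x‖ := by fun_prop
  have e1 : ∀ᶠ x in 𝓝 x₁, q x < ‖g x‖ :=
    hq.continuousAt.eventually_lt hgc.continuousAt hlt
  have e2 : ∀ᶠ x in 𝓝 x₁, ‖g x₁‖ - τ / 3 < ‖g x‖ :=
    continuousAt_const.eventually_lt hgc.continuousAt (by linarith)
  have e3 : ∀ᶠ x in 𝓝 x₁, C * ‖x - x₁‖ < τ / 3 := by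
    have : Continuous fun x => C * ‖x - x₁‖ := by fun_prop
    exact this.continuousAt.eventually_lt continuousAt_const (by simpa using hτ)
  refine ⟨i, norm_eq_of_eventually_norm_eq ((φ i).toLinearMap.restrictScalars ℝ)
    (g : X →ₗ[ℝ] ℂ) (x₀ := x₁) ?_⟩
  -- Functionals other than `φ i` start at least `τ` below and move by less than `τ / 3`, so near
  -- `x₁` only `φ i` can realise `N`.
  filter_upwards [hx₁, e1, e2, e3] with x h0 h1 h2 h3
  refine le_antisymm ?_ (h0 ▸ hφN x i)
  by_contra! hcon
  have := (hN x (max (‖φ i x‖) (max (q x) (‖g x₁‖ - τ / 3)))).2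
    ⟨(le_max_left _ _).trans (le_max_right _ _), fun j => ?_⟩
  · rw [h0] at this
    exact absurd this (not_le.2 (max_lt hcon (max_lt h1 h2)))
  · by_cases hj : j = i
    · exact hj ▸ le_max_left _ _
    · refine le_trans ?_ ((le_max_right _ _).trans (le_max_right _ _))
      have h4 : ‖φ j x‖ ≤ ‖φ j (x - x₁)‖ + ‖φ j x₁‖ := by
        have := norm_add_le (φ j (x - x₁)) (φ j x₁)
        rwa [← map_add, sub_add_cancel] at this
      linarith [hC j (x - x₁), hothers j hj]

/-- The maximum of a seminorm and of the moduli of a bounded family of functionals. -/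
lemma exists_seminorm_le_iff {X ι : Type*} [NormedAddCommGroup X] [NormedSpace ℂ X]
    (φ : ι → X →L[ℂ] ℂ) {C : ℝ} (hC0 : 0 ≤ C) (hC : ∀ i x, ‖φ i x‖ ≤ C * ‖x‖)
    (q : Seminorm ℂ X) :
    ∃ N : Seminorm ℂ X, ∀ x r, N x ≤ r ↔ q x ≤ r ∧ ∀ i, ‖φ i x‖ ≤ r := by
  let p : Option ι → Seminorm ℂ X := fun o =>
    o.elim q fun i => (normSeminorm ℂ ℂ).comp (φ i).toLinearMap
  have hb : BddAbove (Set.range p) := by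
    refine ⟨q + C.toNNReal • normSeminorm ℂ X, ?_⟩
    rintro _ ⟨_ | i, rfl⟩ x
    · have : 0 ≤ C * ‖x‖ := by positivity
      simpa [p, NNReal.smul_def, hC0] using this
    · have := add_le_add (apply_nonneg q x) (hC i x)
      simpa [p, NNReal.smul_def, hC0] using this
  refine ⟨⨆ o, p o, fun x r => ?_⟩
  rw [Seminorm.iSup_apply hb, ciSup_le_iff, Option.forall]
  · simp [p]
  · obtain ⟨s, hs⟩ := hb
    exact ⟨s x, by rintro _ ⟨o, rfl⟩; exact hs ⟨o, rfl⟩ x⟩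

/-! ### The functionals of the renorming and their peaks -/

/-- Indices of the functionals used to renorm a space carrying a biorthogonal system indexed by
a linear order: one for each index, and two for each increasing pair of indices. -/
inductive SpikeIndex (A : Type*) [LT A] where
  | vert (a : A) : SpikeIndex A
  | edge (a b : A) (h : a < b) : SpikeIndex A
  | chord (a b : A) (h : a < b) : SpikeIndex A

/-- A bounded biorthogonal system `(x, f)` indexed by a linear order, with small functionals `h`,
a unimodular parameter `ω`, and a base seminorm `q`. -/
structure SpikeData (X A : Type*) [NormedAddCommGroup X] [NormedSpace ℂ X] [LinearOrder A] where
  x : A → X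
  f : A → X →L[ℂ] ℂ
  h : A → X →L[ℂ] ℂ
  ω : ℂ
  q : Seminorm ℂ X
  lower : ℝ
  upper : ℝ
  lower_pos : 0 < lower
  le_q : ∀ z, lower * ‖z‖ ≤ q z
  q_le : ∀ z, q z ≤ upper * ‖z‖
  f_le : ∀ a z, ‖f a z‖ ≤ upper * ‖z‖
  f_x : ∀ a b, f a (x b) = if a = b then 1 else 0
  h_le : ∀ a z, ‖h a z‖ ≤ q z / 100
  q_x : ∀ a, q (x a) ≤ 1 / 4
  ω_eq : ω = 1 ∨ ω = Complex.I
  q_ne : ∀ (g : X →L[ℝ] ℂ) (x₀ : X), ¬ ∀ᶠ z in 𝓝 x₀, q z = ‖g z‖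

namespace SpikeData

variable {X A : Type*} [NormedAddCommGroup X] [NormedSpace ℂ X] [LinearOrder A]
  (D : SpikeData X A)

/-- The functionals of the renorming. -/
noncomputable def φ : SpikeIndex A → X →L[ℂ] ℂ
  | .vert a => D.f a
  -- Unequal weights record which endpoint is smaller; their sum `9/8` exceeds the value 1 of each
  -- endpoint functional at `x a + x b`.
  | .edge a b _ => (3 / 4 : ℂ) • D.f a + (3 / 8 : ℂ) • D.f b
  -- Each weight is below 1, but the sum `4/3` beats `9/8` by more than the small perturbation `h
  -- a`.
  | .chord a b _ => (2 / 3 : ℂ) • D.f a - (2 / 3 * D.ω) • D.f b + D.h a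

/-- Points at which a functional of the renorming dominates all others. -/
noncomputable def peak : SpikeIndex A → X
  | .vert a => D.x a
  | .edge a b _ => D.x a + D.x b
  | .chord a b _ => D.x a - (starRingEnd ℂ D.ω) • D.x b

lemma norm_ω : ‖D.ω‖ = 1 := by rcases D.ω_eq with h | h <;> simp [h]

lemma ω_mul_conj : D.ω * (starRingEnd ℂ D.ω) = 1 := by
  rw [Complex.mul_conj, Complex.normSq_eq_norm_sq, D.norm_ω]; simp

lemma q_peak (i : SpikeIndex A) : D.q (D.peak i) ≤ 1 / 2 := by
  rcases i with a | ⟨a, b, h⟩ | ⟨a, b, h⟩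
  · exact (D.q_x a).trans (by norm_num)
  · exact (map_add_le_add D.q _ _).trans (by linarith [D.q_x a, D.q_x b])
  · refine (map_sub_le_add D.q _ _).trans ?_
    rw [map_smul_eq_mul, RCLike.norm_conj, D.norm_ω]
    linarith [D.q_x a, D.q_x b]

lemma h_peak (a : A) (i : SpikeIndex A) : ‖D.h a (D.peak i)‖ ≤ 1 / 200 :=
  (D.h_le a _).trans (by linarith [D.q_peak i])

lemma h_x (a b : A) : ‖D.h a (D.x b)‖ ≤ 1 / 200 := D.h_peak a (.vert b)

/-- This is the main part of the chord at `x a + x b`: zero for `ω = 1`, modulus `2√2/3 ≈ 0.943` for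
`ω = i`. With the `1/200` from `h` it stays within `19/20`. -/
lemma norm_two_thirds : ‖(2 / 3 : ℂ) - 2 / 3 * D.ω‖ ≤ 189 / 200 := by
  rcases D.ω_eq with h | h <;> rw [h]
  · norm_num
  · apply le_of_sq_le_sq _ (by norm_num)
    rw [Complex.sq_norm, Complex.normSq_apply]
    norm_num

lemma norm_φ_vert_peak_le (a : A) (j : SpikeIndex A) (hj : j ≠ .vert a) :
    ‖D.φ j (D.x a)‖ ≤ 3 / 4 := by
  rcases j with c | ⟨c, d, hcd⟩ | ⟨c, d, hcd⟩
  · have : c ≠ a := by rintro rfl; exact hj rfl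
    simp [φ, D.f_x, this]; norm_num
  · simp only [φ, add_apply, FunLike.coe_smul, Pi.smul_apply, D.f_x, smul_eq_mul]
    split_ifs with h1 h2
    · exact absurd (h1.trans h2.symm) hcd.ne
    all_goals norm_num
  · have hh := D.h_x c a
    simp only [φ, add_apply, sub_apply, FunLike.coe_smul, Pi.smul_apply, D.f_x, smul_eq_mul]
    refine (norm_add_le _ _).trans ?_
    have : ‖(2 / 3 : ℂ) * (if c = a then 1 else 0) - 2 / 3 * D.ω * (if d = a then 1 else 0)‖
        ≤ 2 / 3 := by
      split_ifs with h1 h2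
      · exact absurd (h1.trans h2.symm) hcd.ne
      all_goals (simp [D.norm_ω]; try norm_num)
    linarith

lemma φ_vert_peak (a : A) : D.φ (.vert a) (D.x a) = 1 := by simp [φ, D.f_x]

lemma φ_edge_peak (a b : A) (h : a < b) : D.φ (.edge a b h) (D.x a + D.x b) = 9 / 8 := by
  simp [φ, D.f_x, h.ne, h.ne']; norm_num

/-- Apart from the edge itself, only its two endpoints reach 1 at this point. The gap down to
`19/20` is what lets `exists_vert_of_norm_le` recognise them. -/
lemma norm_φ_edge_peak_le (a b : A) (h : a < b) (j : SpikeIndex A) (hj : j ≠ .edge a b h)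
    (ha : j ≠ .vert a) (hb : j ≠ .vert b) : ‖D.φ j (D.x a + D.x b)‖ ≤ 19 / 20 := by
  have e : ∀ c, D.f c (D.x a + D.x b) = (if c = a then 1 else 0) + (if c = b then 1 else 0) := by
    intro c; simp [D.f_x]
  rcases j with c | ⟨c, d, hcd⟩ | ⟨c, d, hcd⟩
  · have h1 : c ≠ a := by rintro rfl; exact ha rfl
    have h2 : c ≠ b := by rintro rfl; exact hb rfl
    simp [φ, D.f_x, h1, h2]
    norm_num
  · simp only [φ, add_apply, FunLike.coe_smul, Pi.smul_apply, smul_eq_mul, e]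
    rcases eq_or_ne c a with rfl | h1
    · have h2 : d ≠ b := by rintro rfl; exact hj rfl
      simp [h.ne, hcd.ne', h2]; norm_num
    rcases eq_or_ne c b with rfl | h2
    · simp [h.ne', hcd.ne', (h.trans hcd).ne']; norm_num
    rcases eq_or_ne d a with rfl | h3
    · simp [h.ne, h1, h2]; norm_num
    rcases eq_or_ne d b with rfl | h4
    · simp [h.ne', h1, h2]; norm_num
    · simp [h1, h2, h3, h4]; norm_num
  · have hh := D.h_peak c (.edge a b h)
    simp only [peak] at hh
    simp only [φ, add_apply, sub_apply, FunLike.coe_smul, Pi.smul_apply, smul_eq_mul]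
    refine (norm_add_le _ _).trans ?_
    have : ‖(2 / 3 : ℂ) * D.f c (D.x a + D.x b) - 2 / 3 * D.ω * D.f d (D.x a + D.x b)‖
        ≤ 189 / 200 := by
      simp only [e]
      have h5 := D.norm_two_thirds
      have h6 := D.norm_ω
      rcases eq_or_ne c a with rfl | h1
      · rcases eq_or_ne d b with rfl | h2
        · simpa [h.ne, h.ne'] using h5
        · simp [h.ne, hcd.ne', h2]; norm_num
      rcases eq_or_ne c b with rfl | h2
      · simp [h.ne', hcd.ne', (h.trans hcd).ne']; norm_num
      rcases eq_or_ne d a with rfl | h3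
      · simp [h.ne, h1, h2, h6]; norm_num
      rcases eq_or_ne d b with rfl | h4
      · simp [h.ne', h1, h2, h6]; norm_num
      · simp [h1, h2, h3, h4]; norm_num
    linarith

lemma norm_φ_edge_peak_le_one (a b : A) (h : a < b) (j : SpikeIndex A)
    (hj : j ≠ .edge a b h) : ‖D.φ j (D.x a + D.x b)‖ ≤ 1 := by
  by_cases ha : j = .vert a
  · subst ha; simp [φ, D.f_x, h.ne]
  by_cases hb : j = .vert b
  · subst hb; simp [φ, D.f_x, h.ne']
  exact (D.norm_φ_edge_peak_le a b h j hj ha hb).trans (by norm_num)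

lemma le_norm_φ_chord_peak (a b : A) (h : a < b) :
    13 / 10 ≤ ‖D.φ (.chord a b h) (D.peak (.chord a b h))‖ := by
  have hh := D.h_peak a (.chord a b h)
  have h1 : D.φ (.chord a b h) (D.peak (.chord a b h))
      = 4 / 3 + D.h a (D.peak (.chord a b h)) := by
    have := D.ω_mul_conj
    simp [φ, peak, D.f_x, h.ne, h.ne']
    linear_combination (2 / 3 : ℂ) * this
  rw [h1]
  have := norm_sub_norm_le (4 / 3 : ℂ) (-(D.h a (D.peak (.chord a b h))))
  rw [sub_neg_eq_add, norm_neg] at this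
  have h2 : ‖(4 / 3 : ℂ)‖ = 4 / 3 := by norm_num
  linarith

/-- Only the chord from `a` to `b` sees both terms with total weight above `9/8`. An arbitrary phase
`w` is allowed because an isometry may change the phase at which the chord peaks. -/
lemma norm_φ_add_smul_le (a b : A) (h : a < b) {w : ℂ} (hw : ‖w‖ = 1) (j : SpikeIndex A)
    (hj : j ≠ .chord a b h) : ‖D.φ j (D.x a + w • D.x b)‖ ≤ 9 / 8 := by
  have hω := D.norm_ω
  have e : ∀ c, D.f c (D.x a + w • D.x b) =
      (if c = a then 1 else 0) + w * (if c = b then 1 else 0) := by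
    intro c; simp [D.f_x]
  have e1 : ∀ c, ‖D.f c (D.x a + w • D.x b)‖ ≤ 1 := by
    intro c
    rw [e]
    rcases eq_or_ne c a with rfl | h1
    · simp [h.ne]
    rcases eq_or_ne c b with rfl | h2
    · simp [h.ne', hw]
    · simp [h1, h2]
  rcases j with c | ⟨c, d, hcd⟩ | ⟨c, d, hcd⟩
  · exact (e1 c).trans (by norm_num)
  · simp only [φ, add_apply, FunLike.coe_smul, Pi.smul_apply, smul_eq_mul]
    refine (norm_add_le _ _).trans ?_
    rw [norm_mul, norm_mul, show ‖(3 / 4 : ℂ)‖ = 3 / 4 by norm_num,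
      show ‖(3 / 8 : ℂ)‖ = 3 / 8 by norm_num]
    linarith [e1 c, e1 d]
  · have hh : ‖D.h c (D.x a + w • D.x b)‖ ≤ 1 / 200 := by
      refine (D.h_le c _).trans ?_
      have := map_add_le_add D.q (D.x a) (w • D.x b)
      rw [map_smul_eq_mul, hw] at this
      linarith [D.q_x a, D.q_x b]
    simp only [φ, add_apply, sub_apply, FunLike.coe_smul, Pi.smul_apply, smul_eq_mul]
    refine (norm_add_le _ _).trans ?_
    have : ‖(2 / 3 : ℂ) * D.f c (D.x a + w • D.x b)
        - 2 / 3 * D.ω * D.f d (D.x a + w • D.x b)‖ ≤ 2 / 3 := by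
      simp only [e]
      rcases eq_or_ne c a with rfl | h1
      · have h2 : d ≠ b := by rintro rfl; exact hj rfl
        simp [h.ne, hcd.ne', h2]
      rcases eq_or_ne c b with rfl | h2
      · simp [h.ne', hcd.ne', (h.trans hcd).ne', hw]
      rcases eq_or_ne d a with rfl | h3
      · simp [h.ne, h1, h2, hω]
      rcases eq_or_ne d b with rfl | h4
      · simp [h.ne', h1, h2, hω, hw]
      · simp [h1, h2, h3, h4]; try norm_num
    linarith

lemma norm_φ_chord_peak_le (a b : A) (h : a < b) (j : SpikeIndex A)
    (hj : j ≠ .chord a b h) : ‖D.φ j (D.peak (.chord a b h))‖ ≤ 9 / 8 := by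
  have := D.norm_φ_add_smul_le a b h (w := -(starRingEnd ℂ D.ω))
    (by rw [norm_neg, RCLike.norm_conj, D.norm_ω]) j hj
  rwa [neg_smul, ← sub_eq_add_neg] at this

/-- Each functional of the renorming dominates all others, and `q`, at its peak. -/
lemma norm_φ_peak_gap (i : SpikeIndex A) :
    3 / 4 + 1 / 10 ≤ ‖D.φ i (D.peak i)‖ ∧
      ∀ j, j ≠ i → ‖D.φ j (D.peak i)‖ + 1 / 10 ≤ ‖D.φ i (D.peak i)‖ := by
  rcases i with a | ⟨a, b, h⟩ | ⟨a, b, h⟩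
  · have : ‖D.φ (.vert a) (D.peak (.vert a))‖ = 1 := by
      simp only [peak]; rw [φ_vert_peak]; simp
    rw [this]
    refine ⟨by norm_num, fun j hj => ?_⟩
    have := D.norm_φ_vert_peak_le a j hj
    simp only [peak]; linarith
  · have : ‖D.φ (.edge a b h) (D.peak (.edge a b h))‖ = 9 / 8 := by
      simp only [peak]; rw [φ_edge_peak]; norm_num
    rw [this]
    refine ⟨by norm_num, fun j hj => ?_⟩
    have := D.norm_φ_edge_peak_le_one a b h j hj
    simp only [peak]; linarith
  · have := D.le_norm_φ_chord_peak a b h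
    refine ⟨by linarith, fun j hj => ?_⟩
    have := D.norm_φ_chord_peak_le a b h j hj
    linarith

lemma eq_of_norm_φ_eq {i j : SpikeIndex A} (h : ∀ z, ‖D.φ i z‖ = ‖D.φ j z‖) : i = j := by
  by_contra hij
  have := (D.norm_φ_peak_gap i).2 j (Ne.symm hij)
  rw [h] at this
  linarith

lemma upper_pos [Nonempty A] : 0 < D.upper := by
  obtain ⟨a⟩ := ‹Nonempty A›
  have := D.f_le a (D.x a)
  rw [D.f_x] at this
  simp only [if_true, norm_one] at this
  by_contra! hn
  nlinarith [norm_nonneg (D.x a)]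

lemma norm_φ_le [Nonempty A] (i : SpikeIndex A) (z : X) :
    ‖D.φ i z‖ ≤ 3 * D.upper * ‖z‖ := by
  have hU : 0 ≤ D.upper * ‖z‖ := mul_nonneg D.upper_pos.le (norm_nonneg _)
  rcases i with a | ⟨a, b, h⟩ | ⟨a, b, h⟩
  · have := D.f_le a z
    simp only [φ]; linarith
  · have ha := D.f_le a z
    have hb := D.f_le b z
    simp only [φ, add_apply, FunLike.coe_smul, Pi.smul_apply, smul_eq_mul]
    refine (norm_add_le _ _).trans ?_
    rw [norm_mul, norm_mul]
    norm_num
    linarith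
  · have ha := D.f_le a z
    have hb := D.f_le b z
    have hh := D.h_le a z
    have hq := D.q_le z
    simp only [φ, add_apply, sub_apply, FunLike.coe_smul, Pi.smul_apply, smul_eq_mul]
    refine (norm_add_le _ _).trans ?_
    have := norm_sub_le ((2 / 3 : ℂ) * D.f a z) (2 / 3 * D.ω * D.f b z)
    rw [norm_mul, norm_mul, norm_mul, D.norm_ω] at this
    norm_num at this
    linarith

lemma norm_peak_le (i : SpikeIndex A) : ‖D.peak i‖ ≤ 1 / (2 * D.lower) := by
  have h1 := D.le_q (D.peak i)
  have h2 := D.q_peak i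
  have := D.lower_pos
  rw [le_div_iff₀ (by positivity)]
  linarith

/-- Evaluate at the peak of `φ i`: the values differ by at least `1/10`, while the peak has norm at
most `1 / (2 * lower)`. -/
lemma separated (i j : SpikeIndex A) (hij : i ≠ j) (μ : ℂ) (hμ : ‖μ‖ = 1) :
    D.lower / 5 ≤ ‖D.φ i - μ • D.φ j‖ := by
  have h1 := (D.norm_φ_peak_gap i).2 j hij.symm
  have h2 := (D.φ i - μ • D.φ j).le_opNorm (D.peak i)
  have h3 : ‖(D.φ i - μ • D.φ j) (D.peak i)‖ ≥ 1 / 10 := by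
    have := norm_sub_norm_le (D.φ i (D.peak i)) (μ • D.φ j (D.peak i))
    rw [norm_smul, hμ, one_mul] at this
    simp only [sub_apply, FunLike.coe_smul, Pi.smul_apply]
    linarith
  have h4 := D.norm_peak_le i
  have hl := D.lower_pos
  rw [le_div_iff₀ (by positivity)] at h4
  set y := ‖D.peak i‖
  set n := ‖D.φ i - μ • D.φ j‖
  have hn : 0 ≤ n := norm_nonneg _
  nlinarith

lemma continuous_q : Continuous D.q :=
  continuous_iff_continuousAt.2 fun z => by
    have : ∀ w, |D.q w - D.q z| ≤ D.upper * ‖w - z‖ := fun w =>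
      (abs_sub_map_le_sub D.q w z).trans (D.q_le _)
    refine tendsto_iff_dist_tendsto_zero.2 (squeeze_zero (fun _ => dist_nonneg) this ?_)
    have : Continuous fun w => D.upper * ‖w - z‖ := by fun_prop
    simpa using this.tendsto z

end SpikeData

/-! ### The renorming and the rigidity of its isometries -/

namespace SpikeData

variable {X A : Type*} [NormedAddCommGroup X] [NormedSpace ℂ X] [LinearOrder A]
  (D : SpikeData X A)

/-- Evaluate at the peak of `φ r`. A vertex fails since `9/8 * 3/4 < 1`, a chord since `9/8 * 9/8 <
13/10`. For an edge, `9/8` is reached only if `p` and `s` are its endpoints. This characterises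
edges by a relation that isometries preserve. -/
lemma exists_vert_of_norm_le {p r s : SpikeIndex A} (hrp : p ≠ r) (hrs : s ≠ r) (hps : p ≠ s)
    (h : ∀ z, ‖D.φ r z‖ ≤ 3 / 4 * ‖D.φ p z‖ + 3 / 8 * ‖D.φ s z‖) :
    ∃ a b, ∃ hab : a < b, p = .vert a ∧ s = .vert b ∧ r = .edge a b hab := by
  rcases r with a | ⟨a, b, hab⟩ | ⟨a, b, hab⟩
  · have h0 := h (D.x a)
    rw [D.φ_vert_peak, norm_one] at h0
    have h1 := D.norm_φ_vert_peak_le a p hrp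
    have h2 := D.norm_φ_vert_peak_le a s hrs
    linarith
  · have h0 := h (D.x a + D.x b)
    have hn : ‖(9 / 8 : ℂ)‖ = 9 / 8 := by norm_num
    rw [D.φ_edge_peak, hn] at h0
    have h1 := D.norm_φ_edge_peak_le_one a b hab p hrp
    have h2 := D.norm_φ_edge_peak_le_one a b hab s hrs
    have hp : p = .vert a ∨ p = .vert b := by
      by_contra! hp
      have := D.norm_φ_edge_peak_le a b hab p hrp hp.1 hp.2
      linarith
    have hs : s = .vert a ∨ s = .vert b := by
      by_contra! hs
      have := D.norm_φ_edge_peak_le a b hab s hrs hs.1 hs.2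
      linarith
    rcases hp with rfl | rfl <;> rcases hs with rfl | rfl
    · exact absurd rfl hps
    · exact ⟨a, b, hab, rfl, rfl, rfl⟩
    -- Exchanged endpoints would give `3/4 ≤ 3/8` at `x a`.
    · have h3 := h (D.x a)
      simp [φ, D.f_x, hab.ne'] at h3
      norm_num at h3
    · exact absurd rfl hps
  · have h0 := h (D.peak (.chord a b hab))
    have h1 := D.norm_φ_chord_peak_le a b hab p hrp
    have h2 := D.norm_φ_chord_peak_le a b hab s hrs
    have h3 := D.le_norm_φ_chord_peak a b hab
    linarith

lemma exists_φ_comp {T : X ≃ₗ[ℝ] X} {i j : SpikeIndex A} (h : ∀ z, ‖D.φ i (T z)‖ = ‖D.φ j z‖) :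
    ∃ L : ℂ →ₗᵢ[ℝ] ℂ, ∀ z, D.φ i (T z) = L (D.φ j z) :=
  exists_linearIsometry_of_norm_eq (D.φ j).toLinearMap
    (((D.φ i).toLinearMap.restrictScalars ℝ) ∘ₗ T.toLinearMap) h

variable [Nonempty A]

/-- The renorming. -/
noncomputable def N : Seminorm ℂ X :=
  (exists_seminorm_le_iff D.φ (C := 3 * D.upper) (by linarith [D.upper_pos]) D.norm_φ_le D.q).choose

lemma N_le_iff (z : X) (r : ℝ) : D.N z ≤ r ↔ D.q z ≤ r ∧ ∀ i, ‖D.φ i z‖ ≤ r :=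
  (exists_seminorm_le_iff D.φ (C := 3 * D.upper) (by linarith [D.upper_pos])
    D.norm_φ_le D.q).choose_spec z r

lemma q_le_N (z : X) : D.q z ≤ D.N z := ((D.N_le_iff z _).1 le_rfl).1

lemma norm_φ_le_N (i : SpikeIndex A) (z : X) : ‖D.φ i z‖ ≤ D.N z := ((D.N_le_iff z _).1 le_rfl).2 i

lemma N_le (z : X) : D.N z ≤ 3 * D.upper * ‖z‖ :=
  (D.N_le_iff z _).2 ⟨by
    have := mul_nonneg D.upper_pos.le (norm_nonneg z)
    linarith [D.q_le z], fun i => D.norm_φ_le i z⟩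

lemma isEquivalentNorm_N : IsEquivalentNorm D.N :=
  ⟨D.lower, 3 * D.upper, D.lower_pos, by linarith [D.upper_pos], fun z =>
    ⟨(D.le_q z).trans (D.q_le_N z), D.N_le z⟩⟩

/-- The functionals are equi-Lipschitz, so the gap `1/10` at the peak survives where each of them
moves by at most `1/20`. -/
lemma eventually_N_eq (i : SpikeIndex A) : ∀ᶠ z in 𝓝 (D.peak i), D.N z = ‖D.φ i z‖ := by
  obtain ⟨h1, h2⟩ := D.norm_φ_peak_gap i
  have hq := D.q_peak i
  have e1 : ∀ᶠ z in 𝓝 (D.peak i), D.q z < ‖D.φ i z‖ :=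
    D.continuous_q.continuousAt.eventually_lt
      ((D.φ i).continuous.norm.continuousAt) (by linarith)
  have e2 : ∀ᶠ z in 𝓝 (D.peak i), 3 * D.upper * ‖z - D.peak i‖ < 1 / 20 := by
    have : Continuous fun z => 3 * D.upper * ‖z - D.peak i‖ := by fun_prop
    exact this.continuousAt.eventually_lt continuousAt_const (by simp)
  filter_upwards [e1, e2] with z h3 h4
  refine le_antisymm ((D.N_le_iff _ _).2 ⟨h3.le, fun j => ?_⟩) (D.norm_φ_le_N i z)
  by_cases hj : j = i
  · rw [hj]
  have key : ∀ k, |‖D.φ k z‖ - ‖D.φ k (D.peak i)‖| ≤ 1 / 20 := fun k => by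
    refine (abs_norm_sub_norm_le _ _).trans ?_
    rw [← map_sub]
    exact (D.norm_φ_le k _).trans h4.le
  have k1 := abs_le.1 (key i)
  have k2 := abs_le.1 (key j)
  linarith [h2 j hj]

/-- Near the preimage of the peak, `N` is the modulus of `φ i ∘ T`, which is continuous and
real-linear, so the rigidity of local moduli applies. -/
lemma exists_norm_φ_comp {T : X ≃ₗ[ℝ] X} (hT : IsRealIsometry D.N T) (i : SpikeIndex A) :
    ∃ j, ∀ z, ‖D.φ i (T z)‖ = ‖D.φ j z‖ := by
  have hl := D.lower_pos
  let T' : X →L[ℝ] X := T.toLinearMap.mkContinuous (3 * D.upper / D.lower) fun z => by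
    have h1 := D.le_q (T z)
    have h2 := D.q_le_N (T z)
    rw [hT z] at h2
    have h3 := D.N_le z
    rw [div_mul_eq_mul_div, le_div_iff₀ hl]
    simp only [LinearEquiv.coe_coe]
    linarith
  have hT' : ∀ z, T' z = T z := fun z => rfl
  let g : X →L[ℝ] ℂ := ((D.φ i).restrictScalars ℝ).comp T'
  refine exists_norm_eq_of_eventually_eq_norm D.φ D.norm_φ_le (δ := D.lower / 5) (by positivity)
    D.separated D.continuous_q (fun z => apply_nonneg _ _) D.N_le_iff g (D.q_ne g)
    (x₀ := T.symm (D.peak i)) ?_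
  have hc : Tendsto T' (𝓝 (T.symm (D.peak i))) (𝓝 (D.peak i)) := by
    have := T'.continuous.tendsto (T.symm (D.peak i))
    rwa [hT', T.apply_symm_apply] at this
  filter_upwards [hc.eventually (D.eventually_N_eq i)] with z hz
  rw [hT', hT z] at hz
  exact hz

lemma isRealIsometry_symm {T : X ≃ₗ[ℝ] X} (hT : IsRealIsometry D.N T) :
    IsRealIsometry D.N T.symm := fun z => by
  rw [← hT (T.symm z), T.apply_symm_apply]

lemma N_x_le (a : A) : D.N (D.x a) ≤ 1 := by
  refine (D.N_le_iff _ _).2 ⟨(D.q_x a).trans (by norm_num), fun j => ?_⟩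
  by_cases hj : j = .vert a
  · rw [hj, D.φ_vert_peak, norm_one]
  · exact (D.norm_φ_vert_peak_le a j hj).trans (by norm_num)

lemma norm_h_comp_le {T : X ≃ₗ[ℝ] X} (hT : IsRealIsometry D.N T) (a : A) (z : X) :
    ‖D.h a (T z)‖ ≤ D.N z / 100 := by
  have h1 := D.h_le a (T z)
  have h2 := D.q_le_N (T z)
  rw [hT] at h2
  linarith

variable [Nontrivial A]

/-- The map induced on indices is injective and preserves the inequality between an edge and its
endpoints, with their order. Since there are at least two indices, every vertex is an endpoint. -/
lemma exists_strictMono_vert {T : X ≃ₗ[ℝ] X} (hT : IsRealIsometry D.N T) :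
    ∃ (s : A → A) (hs : StrictMono s), (∀ a z, ‖D.f a (T z)‖ = ‖D.f (s a) z‖) ∧
      ∀ a b (hab : a < b) z,
        ‖D.φ (.edge a b hab) (T z)‖ = ‖D.φ (.edge (s a) (s b) (hs hab)) z‖ := by
  choose σ hσ using D.exists_norm_φ_comp hT
  have hinj : ∀ i j, σ i = σ j → i = j := fun i j hij => D.eq_of_norm_φ_eq fun z => by
    rw [← T.apply_symm_apply z, hσ, hσ, hij]
  have key : ∀ a b (hab : a < b), ∃ c d, ∃ hcd : c < d, σ (.vert a) = .vert c ∧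
      σ (.vert b) = .vert d ∧ σ (.edge a b hab) = .edge c d hcd := by
    intro a b hab
    refine D.exists_vert_of_norm_le (r := σ (.edge a b hab)) (fun h => ?_) (fun h => ?_)
      (fun h => ?_) fun z => ?_
    · cases hinj _ _ h
    · cases hinj _ _ h
    · cases hinj _ _ h; exact absurd hab (lt_irrefl _)
    · rw [← hσ, ← hσ, ← hσ]
      simp only [φ, add_apply, FunLike.coe_smul, Pi.smul_apply, smul_eq_mul]
      refine (norm_add_le _ _).trans (le_of_eq ?_)
      rw [norm_mul, norm_mul]
      norm_num
  have hs : ∀ a, ∃ c, σ (.vert a) = .vert c := fun a => by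
    obtain ⟨b, hb⟩ := exists_ne a
    rcases lt_or_gt_of_ne hb with h | h
    · obtain ⟨c, d, -, -, h2, -⟩ := key _ _ h
      exact ⟨d, h2⟩
    · obtain ⟨c, d, -, h1, -⟩ := key _ _ h
      exact ⟨c, h1⟩
  choose s hs using hs
  have key' : ∀ a b (hab : a < b), ∃ h : s a < s b, σ (.edge a b hab) = .edge (s a) (s b) h := by
    intro a b hab
    obtain ⟨c, d, hcd, h1, h2, h3⟩ := key a b hab
    rw [hs] at h1 h2
    cases h1; cases h2
    exact ⟨hcd, h3⟩
  refine ⟨s, fun a b hab => (key' a b hab).1, fun a z => ?_, fun a b hab z => ?_⟩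
  · have := hσ (.vert a) z
    rw [hs] at this
    exact this
  · rw [hσ, (key' a b hab).2]

variable [WellFoundedLT A]

/-- A strictly increasing self-map of a well-order lies above the identity; applied to the map of
`T` and to that of `T.symm`, this leaves only the identity. -/
lemma norm_φ_comp_of_isRealIsometry {T : X ≃ₗ[ℝ] X} (hT : IsRealIsometry D.N T) :
    (∀ a z, ‖D.f a (T z)‖ = ‖D.f a z‖) ∧
      ∀ a b (hab : a < b) z, ‖D.φ (.edge a b hab) (T z)‖ = ‖D.φ (.edge a b hab) z‖ := by
  obtain ⟨s, hs, hsT, hsE⟩ := D.exists_strictMono_vert hT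
  obtain ⟨s', hs', hsT', -⟩ := D.exists_strictMono_vert (D.isRealIsometry_symm hT)
  have h1 : ∀ a, s' (s a) = a := fun a => by
    have := D.eq_of_norm_φ_eq (i := .vert (s' (s a))) (j := .vert a) fun z => by
      simp only [φ]
      rw [← hsT', ← hsT, T.apply_symm_apply]
    exact SpikeIndex.vert.inj this
  have h2 : s = id := funext fun a =>
    le_antisymm (by conv_rhs => rw [id, ← h1 a]
                    exact hs'.le_apply) hs.le_apply
  subst h2
  exact ⟨hsT, hsE⟩

/-- An isometry acts on all the functionals `f a` by the same isometry of `ℂ`. -/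
lemma exists_f_comp {T : X ≃ₗ[ℝ] X} (hT : IsRealIsometry D.N T) :
    ∃ L : ℂ →ₗᵢ[ℝ] ℂ, ∀ a z, D.f a (T z) = L (D.f a z) := by
  obtain ⟨h1, h2⟩ := D.norm_φ_comp_of_isRealIsometry hT
  choose L hL using fun a => D.exists_φ_comp (i := .vert a) (j := .vert a) (T := T) (h1 a)
  simp only [φ] at hL
  have key : ∀ a b, a < b → L a = L b := by
    intro a b hab
    -- The edge transforms by a single `M`; testing on multiples of `x a` and of `x b` identifies it
    -- with `L a` and with `L b`.
    obtain ⟨M, hM⟩ := D.exists_φ_comp (h2 a b hab)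
    simp only [φ, add_apply, FunLike.coe_smul, Pi.smul_apply, smul_eq_mul, hL] at hM
    have e1 : ∀ (r : ℝ) (w : ℂ), M (r * w) = r * M w := fun r w => by
      rw [← Complex.real_smul, map_smul, Complex.real_smul]
    have hMa : ∀ w, M w = L a w := fun w => by
      have := hM (w • D.x a)
      simp [D.f_x, hab.ne'] at this
      have h3 := e1 (3 / 4) w
      push_cast at h3
      rw [h3] at this
      exact (mul_left_cancel₀ (by norm_num) this).symm
    have hMb : ∀ w, M w = L b w := fun w => by
      have := hM (w • D.x b)
      simp [D.f_x, hab.ne] at this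
      have h3 := e1 (3 / 8) w
      push_cast at h3
      rw [h3] at this
      exact (mul_left_cancel₀ (by norm_num) this).symm
    ext1 w
    rw [← hMa, hMb]
  obtain ⟨a⟩ := (inferInstance : Nonempty A)
  refine ⟨L a, fun b z => ?_⟩
  rw [hL]
  rcases lt_trichotomy a b with h | rfl | h
  · rw [key _ _ h]
  · rfl
  · rw [key _ _ h]

omit [Nontrivial A] [WellFoundedLT A] in
/-- An isometry acting on all `f a` by the same isometry of `ℂ` preserves the chords up to
phases. -/
lemma norm_chord_comp {T : X ≃ₗ[ℝ] X} (hT : IsRealIsometry D.N T) {L : ℂ →ₗᵢ[ℝ] ℂ}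
    (hL : ∀ a z, D.f a (T z) = L (D.f a z)) (a b : A) (hab : a < b) (z : X) :
    ‖D.φ (.chord a b hab) (T z)‖ = ‖D.φ (.chord a b hab) z‖ := by
  obtain ⟨j, hj⟩ := D.exists_norm_φ_comp hT (.chord a b hab)
  suffices j = .chord a b hab by rw [hj, this]
  by_contra hne
  -- This phase makes the two chord terms add up after `T`, giving modulus at least `4/3 - 1/50`,
  -- too large for any other functional at that point.
  obtain ⟨w, hw⟩ := (L.toLinearIsometryEquiv rfl).surjective (-(starRingEnd ℂ D.ω) * L 1)
  replace hw : L w = -(starRingEnd ℂ D.ω) * L 1 := hw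
  have hw1 : ‖w‖ = 1 := by
    rw [← L.norm_map, hw, norm_mul, norm_neg, RCLike.norm_conj, D.norm_ω, L.norm_map]; simp
  have h1 := D.norm_φ_add_smul_le a b hab hw1 j hne
  rw [← hj] at h1
  have h2 : D.φ (.chord a b hab) (T (D.x a + w • D.x b))
      = 4 / 3 * L 1 + D.h a (T (D.x a + w • D.x b)) := by
    have := D.ω_mul_conj
    simp [φ, D.f_x, hL, hab.ne, hab.ne', hw]
    linear_combination (2 / 3 * L 1) * this
  have h3 : D.N (D.x a + w • D.x b) ≤ 2 := by
    refine (map_add_le_add _ _ _).trans ?_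
    rw [map_smul_eq_mul, hw1]
    linarith [D.N_x_le a, D.N_x_le b]
  have h4 := D.norm_h_comp_le hT a (D.x a + w • D.x b)
  have h5 := norm_sub_norm_le (4 / 3 * L 1) (-(D.h a (T (D.x a + w • D.x b))))
  rw [sub_neg_eq_add, norm_neg, norm_mul, L.norm_map, ← h2, norm_one,
    show ‖(4 / 3 : ℂ)‖ = 4 / 3 by norm_num] at h5
  linarith

omit [Nontrivial A] [WellFoundedLT A] in
lemma exists_chord_comp {T : X ≃ₗ[ℝ] X} (hT : IsRealIsometry D.N T) {L : ℂ →ₗᵢ[ℝ] ℂ}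
    (hL : ∀ a z, D.f a (T z) = L (D.f a z)) (a b : A) (hab : a < b) :
    ∃ M : ℂ →ₗᵢ[ℝ] ℂ, ∀ z, M (D.φ (.chord a b hab) z) =
      2 / 3 * L (D.f a z) - 2 / 3 * D.ω * L (D.f b z) + D.h a (T z) := by
  obtain ⟨M, hM⟩ := D.exists_φ_comp (D.norm_chord_comp hT hL a b hab)
  exact ⟨M, fun z => by rw [← hM]; simp [φ, hL]⟩

omit [WellFoundedLT A] in
-- Only `ω = i` with `L` conjugate-linear needs an argument. The chord values at `i • x a` and `x b`
-- then cancel up to `h`, while their images under `T` add up to modulus `4/3` up to `h`.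
lemma map_ω_mul {T : X ≃ₗ[ℝ] X} (hT : IsRealIsometry D.N T) {L : ℂ →ₗᵢ[ℝ] ℂ}
    (hL : ∀ a z, D.f a (T z) = L (D.f a z)) (w : ℂ) : L (D.ω * w) = D.ω * L w := by
  rcases D.ω_eq with hω | hω
  · simp [hω]
  obtain ⟨a, b, hab⟩ := exists_pair_lt A
  obtain ⟨M, hM⟩ := D.exists_chord_comp hT hL a b hab
  obtain ⟨μ, hμ, hμL⟩ := L.exists_eq_mul
  rcases hμL with hμL | hμL
  · rw [hμL, hμL]; ring
  exfalso
  have e1 : ∀ (r : ℝ) (w : ℂ), M (r * w) = r * M w := fun r w => by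
    rw [← Complex.real_smul, map_smul, Complex.real_smul]
  have v1 : D.φ (.chord a b hab) (Complex.I • D.x a)
      = ((2 / 3 : ℝ) : ℂ) * Complex.I + Complex.I * D.h a (D.x a) := by
    simp [φ, D.f_x, hab.ne']; ring
  have v2 : D.φ (.chord a b hab) (D.x b)
      = -(((2 / 3 : ℝ) : ℂ) * Complex.I) + D.h a (D.x b) := by
    simp [φ, D.f_x, hab.ne, hω]
  have h1 := hM (Complex.I • D.x a)
  have h2 := hM (D.x b)
  rw [v1, map_add, e1] at h1
  rw [v2, map_add, map_neg, e1] at h2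
  have b1 := D.norm_h_comp_le hT a (Complex.I • D.x a)
  have b2 := D.norm_h_comp_le hT a (D.x b)
  have b3 : ‖M (Complex.I * D.h a (D.x a))‖ ≤ 1 / 200 := by
    rw [M.norm_map, norm_mul, Complex.norm_I, one_mul]; exact D.h_x a a
  have b4 : ‖M (D.h a (D.x b))‖ ≤ 1 / 200 := by
    rw [M.norm_map]; exact D.h_x a b
  rw [map_smul_eq_mul, Complex.norm_I, one_mul] at b1
  have n1 := D.N_x_le a
  have n2 := D.N_x_le b
  simp [D.f_x, hab.ne, hab.ne', hμL, hω, -Complex.coe_smul] at h1 h2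
  have h3 : (4 / 3 : ℂ) * (Complex.I * μ) = D.h a (T (Complex.I • D.x a)) + D.h a (T (D.x b))
      - M (Complex.I * D.h a (D.x a)) - M (D.h a (D.x b)) := by
    linear_combination h1 + h2
  have h4 : ‖(4 / 3 : ℂ) * (Complex.I * μ)‖ = 4 / 3 := by
    rw [norm_mul, norm_mul, hμ, Complex.norm_I]; norm_num
  rw [h3] at h4
  have t1 := norm_sub_le (D.h a (T (Complex.I • D.x a)) + D.h a (T (D.x b))
      - M (Complex.I * D.h a (D.x a))) (M (D.h a (D.x b)))
  have t2 := norm_sub_le (D.h a (T (Complex.I • D.x a)) + D.h a (T (D.x b)))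
    (M (Complex.I * D.h a (D.x a)))
  have t3 := norm_add_le (D.h a (T (Complex.I • D.x a))) (D.h a (T (D.x b)))
  linarith

omit [Nonempty A] [Nontrivial A] [WellFoundedLT A] in
/-- Comparison of two real-linear images of distinct chords at the peak of one of them. -/
lemma opNorm_le_of_comp_chord {a b c : A} (hab : a < b) (hac : a < c) (hbc : b ≠ c)
    {K K' : ℂ →L[ℝ] ℂ}
    (hK : ∀ z, K (D.φ (.chord a b hab) z) = K' (D.φ (.chord a c hac) z)) :
    ‖K‖ ≤ 9 / 10 * ‖K'‖ := by
  refine ContinuousLinearMap.opNorm_le_bound _ (by positivity) fun w => ?_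
  set y := D.peak (.chord a b hab)
  set v := D.φ (.chord a b hab) y with hv
  have h1 : 13 / 10 ≤ ‖v‖ := D.le_norm_φ_chord_peak a b hab
  have hv0 : v ≠ 0 := by
    intro h; rw [h, norm_zero] at h1; norm_num at h1
  have h2 : ‖D.φ (.chord a c hac) y‖ ≤ 9 / 8 :=
    D.norm_φ_chord_peak_le a b hab _ (by
      intro h; exact hbc (SpikeIndex.chord.inj h).2.symm)
  have h3 := hK ((w / v) • y)
  rw [map_smul, ← hv, smul_eq_mul, div_mul_cancel₀ _ hv0, map_smul, smul_eq_mul] at h3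
  rw [h3]
  refine (K'.le_opNorm _).trans ?_
  -- The ratio is `(9/8) / (13/10) < 9/10`.
  have h4 : ‖w / v * D.φ (.chord a c hac) y‖ ≤ 9 / 10 * ‖w‖ := by
    rw [norm_mul, norm_div, div_mul_eq_mul_div, div_le_iff₀ (by linarith)]
    nlinarith [norm_nonneg w]
  calc _ ≤ ‖K'‖ * (9 / 10 * ‖w‖) := by gcongr
    _ = _ := by ring

omit [WellFoundedLT A] in
-- The two chords share `h a`, so the defect `h a ∘ T - L ∘ h a` factors through both, as `K` and as
-- `K'`. Each operator norm is at most `9/10` of the other, so both vanish.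
lemma h_comp {T : X ≃ₗ[ℝ] X} (hT : IsRealIsometry D.N T) {L : ℂ →ₗᵢ[ℝ] ℂ}
    (hL : ∀ a z, D.f a (T z) = L (D.f a z)) {a b c : A} (hab : a < b) (hac : a < c)
    (hbc : b ≠ c) (z : X) : D.h a (T z) = L (D.h a z) := by
  have e1 : ∀ (w : ℂ), L (2 / 3 * w) = 2 / 3 * L w := fun w => by
    have := L.map_smul (2 / 3) w
    rw [Complex.real_smul, Complex.real_smul] at this
    push_cast at this
    exact this
  have hφ : ∀ d (had : a < d) z, L (D.φ (.chord a d had) z) =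
      2 / 3 * L (D.f a z) - 2 / 3 * D.ω * L (D.f d z) + L (D.h a z) := by
    intro d had z
    simp only [φ, add_apply, sub_apply, FunLike.coe_smul, Pi.smul_apply, smul_eq_mul]
    rw [map_add, map_sub, mul_assoc, e1, e1, D.map_ω_mul hT hL, mul_assoc]
  obtain ⟨M, hM⟩ := D.exists_chord_comp hT hL a b hab
  obtain ⟨M', hM'⟩ := D.exists_chord_comp hT hL a c hac
  let K : ℂ →L[ℝ] ℂ := M.toContinuousLinearMap - L.toContinuousLinearMap
  let K' : ℂ →L[ℝ] ℂ := M'.toContinuousLinearMap - L.toContinuousLinearMap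
  have hK : ∀ z, K (D.φ (.chord a b hab) z) = D.h a (T z) - L (D.h a z) := fun z => by
    simp [K, hM, hφ]
  have hK' : ∀ z, K' (D.φ (.chord a c hac) z) = D.h a (T z) - L (D.h a z) := fun z => by
    simp [K', hM', hφ]
  have n1 := D.opNorm_le_of_comp_chord hab hac hbc fun z => (hK z).trans (hK' z).symm
  have n2 := D.opNorm_le_of_comp_chord hac hab hbc.symm fun z => (hK' z).trans (hK z).symm
  have : ‖K‖ = 0 := le_antisymm (by linarith) (norm_nonneg _)
  rw [norm_eq_zero] at this
  have h := hK z
  rw [this] at h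
  exact (sub_eq_zero.1 h.symm)

/-- Every isometry acts on all `f a` and `h a` by the same rotation of `ℂ` or, if `ω = 1`, by the
same rotation of the complex conjugate. -/
lemma exists_comp_of_isRealIsometry {T : X ≃ₗ[ℝ] X} (hT : IsRealIsometry D.N T)
    (htop : ∀ a, D.h a = 0 ∨ ∃ b c, a < b ∧ b < c) :
    ∃ μ : ℂ, ‖μ‖ = 1 ∧
      (((∀ a z, D.f a (T z) = μ * D.f a z) ∧ ∀ a z, D.h a (T z) = μ * D.h a z) ∨
      (D.ω = 1 ∧ (∀ a z, D.f a (T z) = μ * (starRingEnd ℂ) (D.f a z)) ∧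
        ∀ a z, D.h a (T z) = μ * (starRingEnd ℂ) (D.h a z))) := by
  obtain ⟨L, hL⟩ := D.exists_f_comp hT
  have hh : ∀ a z, D.h a (T z) = L (D.h a z) := by
    intro a z
    rcases htop a with h | ⟨b, c, hab, hbc⟩
    · simp [h]
    · exact D.h_comp hT hL hab (hab.trans hbc) hbc.ne z
  obtain ⟨μ, hμ, hμL⟩ := L.exists_eq_mul
  refine ⟨μ, hμ, ?_⟩
  rcases hμL with h | h
  · left
    simp only [hL, hh, h, implies_true, and_self]
  · right
    refine ⟨D.ω_eq.resolve_right fun hω => ?_, by simp only [hL, hh, h, implies_true, and_self]⟩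
    have := D.map_ω_mul hT hL 1
    have hμ0 : μ ≠ 0 := by rintro rfl; simp at hμ
    rw [hω, h, h] at this
    have h2 : μ * Complex.I = 0 := by
      simp at this
      linear_combination (-1 / 2 : ℂ) * this
    simp [hμ0] at h2

omit [Nontrivial A] [WellFoundedLT A] in
/-- A conjugation compatible with the data is isometric for the renorming. -/
lemma N_comp_conj (hω : D.ω = 1) {c : X → X} (hq : ∀ z, D.q (c z) = D.q z)
    (hf : ∀ a z, D.f a (c z) = (starRingEnd ℂ) (D.f a z))
    (hh : ∀ a z, D.h a (c z) = (starRingEnd ℂ) (D.h a z)) (z : X) : D.N (c z) = D.N z := by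
  have hφ : ∀ i, D.φ i (c z) = (starRingEnd ℂ) (D.φ i z) := by
    rintro (a | ⟨a, b, h⟩ | ⟨a, b, h⟩) <;>
      simp [φ, hω, hf, hh, Complex.conj_ofNat]
  refine eq_of_forall_ge_iff fun r => ?_
  rw [D.N_le_iff, D.N_le_iff, hq]
  simp only [hφ, RCLike.norm_conj]

end SpikeData

/-! ### The base norm and the rescaled data -/

/-- The Hilbertian combination of a seminorm and the moduli of two functionals. -/
noncomputable def hilbertSeminorm {X : Type*} [AddCommGroup X] [Module ℂ X]
    (p : Seminorm ℂ X) (f g : X →ₗ[ℂ] ℂ) : Seminorm ℂ X :=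
  Seminorm.of (fun z => √(p z ^ 2 + ‖f z‖ ^ 2 + ‖g z‖ ^ 2))
    (fun z w => by
      have key : ∀ a b c : ℝ, √(a ^ 2 + b ^ 2 + c ^ 2) = ‖!₂[a, b, c]‖ := fun a b c => by
        simp [EuclideanSpace.norm_eq, Fin.sum_univ_three]
      have h := norm_add_le !₂[p z, ‖f z‖, ‖g z‖] !₂[p w, ‖f w‖, ‖g w‖]
      have e : !₂[p z, ‖f z‖, ‖g z‖] + !₂[p w, ‖f w‖, ‖g w‖]
          = !₂[p z + p w, ‖f z‖ + ‖f w‖, ‖g z‖ + ‖g w‖] := by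
        ext i; fin_cases i <;> simp
      rw [e, ← key, ← key, ← key] at h
      refine le_trans (Real.sqrt_le_sqrt ?_) h
      have h1 := map_add_le_add p z w
      have h2 : ‖f (z + w)‖ ≤ ‖f z‖ + ‖f w‖ := by rw [map_add]; exact norm_add_le _ _
      have h3 : ‖g (z + w)‖ ≤ ‖g z‖ + ‖g w‖ := by rw [map_add]; exact norm_add_le _ _
      gcongr)
    (fun c z => by
      rw [map_smul_eq_mul, map_smul, map_smul, norm_smul, norm_smul, mul_pow, mul_pow, mul_pow,
        ← mul_add, ← mul_add, Real.sqrt_mul (by positivity), Real.sqrt_sq (norm_nonneg c)])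

section

variable {X : Type*} [AddCommGroup X] [Module ℂ X] (p : Seminorm ℂ X) (f g : X →ₗ[ℂ] ℂ)

lemma hilbertSeminorm_apply (z : X) :
    hilbertSeminorm p f g z = √(p z ^ 2 + ‖f z‖ ^ 2 + ‖g z‖ ^ 2) := rfl

lemma hilbertSeminorm_sq (z : X) :
    hilbertSeminorm p f g z ^ 2 = p z ^ 2 + ‖f z‖ ^ 2 + ‖g z‖ ^ 2 := by
  rw [hilbertSeminorm_apply, Real.sq_sqrt (by positivity)]

lemma le_hilbertSeminorm (z : X) : p z ≤ hilbertSeminorm p f g z :=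
  Real.le_sqrt_of_sq_le (by nlinarith [sq_nonneg ‖f z‖, sq_nonneg ‖g z‖])

lemma hilbertSeminorm_le (z : X) : hilbertSeminorm p f g z ≤ p z + ‖f z‖ + ‖g z‖ := by
  have := apply_nonneg p z
  refine (Real.sqrt_le_left (by positivity)).2 ?_
  nlinarith [norm_nonneg (f z), norm_nonneg (g z), mul_nonneg this (norm_nonneg (f z)),
    mul_nonneg this (norm_nonneg (g z)), mul_nonneg (norm_nonneg (f z)) (norm_nonneg (g z))]

/-- Four real dimensions of uniform convexity prevent a norm from being locally the modulus of a
real-linear map into `ℂ`. -/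
lemma hilbertSeminorm_ne_norm {X : Type*} [NormedAddCommGroup X] [NormedSpace ℂ X]
    (p : Seminorm ℂ X) (f g : X →ₗ[ℂ] ℂ) {u v : X} (hfu : f u = 1) (hfv : f v = 0)
    (hgu : g u = 0) (hgv : g v = 1) (k : X →ₗ[ℝ] ℂ) (x₀ : X) :
    ¬ ∀ᶠ z in 𝓝 x₀, hilbertSeminorm p f g z = ‖k z‖ := by
  intro hev
  let G : (ℂ × ℂ) →ₗ[ℝ] X :=
    ((LinearMap.toSpanSingleton ℂ X u).restrictScalars ℝ).coprod
      ((LinearMap.toSpanSingleton ℂ X v).restrictScalars ℝ)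
  -- A real-linear map from four to two real dimensions kills some `w ≠ 0`. Along `w` the modulus of
  -- `k` is constant, whereas the squared seminorm is strictly convex.
  have hker : LinearMap.ker (k ∘ₗ G) ≠ ⊥ := by
    apply LinearMap.ker_ne_bot_of_finrank_lt
    rw [Module.finrank_prod, Complex.finrank_real_complex]
    norm_num
  obtain ⟨⟨c, d⟩, hcd, hne⟩ := (Submodule.ne_bot_iff _).1 hker
  set w : X := c • u + d • v with hw
  have hkw : k w = 0 := hcd
  have hfw : f w = c := by simp [hw, hfu, hfv]
  have hgw : g w = d := by simp [hw, hgu, hgv]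
  have hc : ∀ s : ℝ, Tendsto (fun t : ℝ => x₀ + (s * t) • w) (𝓝[≠] 0) (𝓝 x₀) := by
    intro s
    have : Continuous (fun t : ℝ => x₀ + (s * t) • w) := by fun_prop
    have h1 := this.tendsto 0
    simp only [mul_zero, zero_smul, add_zero] at h1
    exact h1.mono_left nhdsWithin_le_nhds
  obtain ⟨t, ⟨h1, h2⟩, ht⟩ :=
    (((hc 1).eventually hev).and ((hc (-1)).eventually hev)).and
      (eventually_mem_nhdsWithin (a := (0 : ℝ)) (s := {0}ᶜ)) |>.exists
  have h0 := hev.self_of_nhds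
  have ht0 : (t : ℂ) ≠ 0 := by simpa using ht
  have e : ∀ s : ℝ, k (x₀ + s • w) = k x₀ := fun s => by simp [hkw]
  rw [e, ← h0] at h1 h2
  set y : X := (t : ℂ) • w with hy
  have e1 : x₀ + (1 * t) • w = x₀ + y := by simp [hy]
  have e2 : x₀ + (-1 * t) • w = x₀ - y := by simp [hy, sub_eq_add_neg]
  rw [e1] at h1
  rw [e2] at h2
  have s0 := hilbertSeminorm_sq p f g x₀
  have s1 := hilbertSeminorm_sq p f g (x₀ + y)
  have s2 := hilbertSeminorm_sq p f g (x₀ - y)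
  rw [h1] at s1
  rw [h2] at s2
  have pf := parallelogram_law_with_norm ℝ (f x₀) (f y)
  have pg := parallelogram_law_with_norm ℝ (g x₀) (g y)
  rw [← map_add, ← map_sub] at pf pg
  have hp : 2 * p x₀ ≤ p (x₀ + y) + p (x₀ - y) := by
    have := map_add_le_add p (x₀ + y) (x₀ - y)
    have e3 : x₀ + y + (x₀ - y) = (2 : ℂ) • x₀ := by rw [two_smul]; abel
    rw [e3, map_smul_eq_mul] at this
    simpa using this
  have hp2 : 2 * p x₀ ^ 2 ≤ p (x₀ + y) ^ 2 + p (x₀ - y) ^ 2 := by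
    nlinarith [sq_nonneg (p (x₀ + y) - p (x₀ - y)), apply_nonneg p x₀]
  have hpos : 0 < ‖f y‖ * ‖f y‖ + ‖g y‖ * ‖g y‖ := by
    rw [hy, map_smul, map_smul, hfw, hgw]
    have : c ≠ 0 ∨ d ≠ 0 := by
      by_contra! h
      exact hne (by simp [h.1, h.2])
    rcases this with h | h
    · have : 0 < ‖(t : ℂ) • c‖ := norm_pos_iff.2 (smul_ne_zero ht0 h)
      positivity
    · have : 0 < ‖(t : ℂ) • d‖ := norm_pos_iff.2 (smul_ne_zero ht0 h)
      positivity
  nlinarith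

end

/-- A bounded biorthogonal system and a bounded family of functionals give, after rescaling,
the data of a renorming. -/
lemma exists_spikeData {X A : Type*} [NormedAddCommGroup X] [NormedSpace ℂ X] [LinearOrder A]
    [Nontrivial A] (x : A → X) (f h : A → X →L[ℂ] ℂ) {M : ℝ} (hx : ∀ a, ‖x a‖ ≤ M)
    (hf : ∀ a, ‖f a‖ ≤ M) (hh : ∀ a, ‖h a‖ ≤ M)
    (hfx : ∀ a b, f a (x b) = if a = b then 1 else 0) {ω : ℂ} (hω : ω = 1 ∨ ω = Complex.I)
    {p : Seminorm ℂ X} (hp : IsEquivalentNorm p) :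
    ∃ D : SpikeData X A, D.f = f ∧ D.ω = ω ∧ (∃ ε : ℝ, ε ≠ 0 ∧ ∀ a, D.h a = (ε : ℂ) • h a) ∧
      ∀ z w, p z = p w → (∀ a, ‖f a z‖ = ‖f a w‖) → D.q z = D.q w := by
  obtain ⟨l, u, hl, hu, hp⟩ := hp
  obtain ⟨a₀, a₁, hne⟩ := exists_pair_ne A
  have hM : 0 ≤ M := (norm_nonneg _).trans (hx a₀)
  have hfM : ∀ a z, ‖f a z‖ ≤ M * ‖z‖ := fun a z =>
    ((f a).le_opNorm z).trans (by gcongr; exact hf a)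
  set Q := hilbertSeminorm p (f a₀).toLinearMap (f a₁).toLinearMap with hQ
  have hQu : ∀ z, Q z ≤ (u + 2 * M) * ‖z‖ := fun z => by
    have h1 := hilbertSeminorm_le p (f a₀).toLinearMap (f a₁).toLinearMap z
    have h2 : ‖f a₀ z‖ ≤ _ := hfM a₀ z
    have h3 : ‖f a₁ z‖ ≤ _ := hfM a₁ z
    have h4 := (hp z).2
    simp only [ContinuousLinearMap.coe_coe] at h1
    linarith
  have hQl : ∀ z, l * ‖z‖ ≤ Q z := fun z => (hp z).1.trans (le_hilbertSeminorm _ _ _ z)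
  -- `κ` shrinks the base norm until `q (x a) ≤ 1/4`; `ε` below then shrinks `h` until `‖h a z‖ ≤ q
  -- z / 100`.
  set κ : ℝ := (4 * ((u + 2 * M) * (M + 1)))⁻¹ with hκ
  have hκ0 : 0 < κ := by positivity
  have hκ1 : κ * ((u + 2 * M) * (M + 1)) = 1 / 4 := by
    rw [hκ]; field_simp
  set ε : ℝ := κ * l / (100 * (M + 1)) with hε
  have hε0 : 0 < ε := by positivity
  have hε1 : ε * (M + 1) = κ * l / 100 := by rw [hε]; field_simp
  have hq : ∀ z, (κ.toNNReal • Q) z = κ * Q z := fun z => by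
    simp [NNReal.smul_def, hκ0.le]
  refine ⟨{
    x := x
    f := f
    h := fun a => (ε : ℂ) • h a
    ω := ω
    q := κ.toNNReal • Q
    lower := κ * l
    upper := max (κ * (u + 2 * M)) M
    lower_pos := by positivity
    le_q := fun z => ?_
    q_le := fun z => ?_
    f_le := fun a z => ?_
    f_x := hfx
    h_le := fun a z => ?_
    q_x := fun a => ?_
    ω_eq := hω
    q_ne := fun g x₀ => ?_ }, rfl, rfl, ⟨ε, hε0.ne', fun a => rfl⟩, fun z w hzw hfzw => ?_⟩
  · rw [hq, mul_assoc]
    exact mul_le_mul_of_nonneg_left (hQl z) hκ0.le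
  · rw [hq]
    calc κ * Q z ≤ κ * ((u + 2 * M) * ‖z‖) := by gcongr; exact hQu z
      _ = κ * (u + 2 * M) * ‖z‖ := by ring
      _ ≤ _ := by gcongr; exact le_max_left _ _
  · exact (hfM a z).trans (by gcongr; exact le_max_right _ _)
  · have h1 : ‖h a z‖ ≤ (M + 1) * ‖z‖ :=
      ((h a).le_opNorm z).trans (by gcongr; linarith [hh a])
    calc ‖((ε : ℂ) • h a) z‖ = ε * ‖h a z‖ := by simp [abs_of_pos hε0]
      _ ≤ ε * ((M + 1) * ‖z‖) := by gcongr
      _ = κ * (l * ‖z‖) / 100 := by rw [← mul_assoc, hε1]; ring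
      _ ≤ _ := by rw [hq]; gcongr; exact hQl z
  · rw [hq, ← hκ1]
    gcongr
    refine (hQu _).trans ?_
    gcongr
    linarith [hx a]
  · intro hev
    have := hilbertSeminorm_ne_norm p (f a₀).toLinearMap (f a₁).toLinearMap
      (u := x a₀) (v := x a₁) (by simp [hfx]) (by simp [hfx, hne]) (by simp [hfx, hne.symm])
      (by simp [hfx]) (κ⁻¹ • (g : X →ₗ[ℝ] ℂ)) x₀
    refine this (hev.mono fun z hz => ?_)
    rw [hq] at hz
    rw [LinearMap.smul_apply, norm_smul, ContinuousLinearMap.coe_coe, ← hz, norm_inv,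
      Real.norm_of_nonneg hκ0.le, inv_mul_cancel_left₀ hκ0.ne']
  · change (κ.toNNReal • Q) z = (κ.toNNReal • Q) w
    rw [hq, hq, hQ, hilbertSeminorm_apply, hilbertSeminorm_apply]
    simp [hzw, hfzw]

/-! ### Bounded biorthogonal systems with a total family -/

/-- A set of functionals separating points from zero. -/
def IsTotalSet {𝕜 E : Type*} [RCLike 𝕜] [NormedAddCommGroup E] [NormedSpace 𝕜 E]
    (S : Set (StrongDual 𝕜 E)) : Prop :=
  ∀ z, (∀ g ∈ S, g z = 0) → z = 0

/-- A set of contractive functionals which is `1/2`-norming for a subspace. -/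
def IsHalfNorming {𝕜 E : Type*} [RCLike 𝕜] [NormedAddCommGroup E] [NormedSpace 𝕜 E]
    (F : Submodule 𝕜 E) (G : Set (StrongDual 𝕜 E)) : Prop :=
  ∀ y ∈ F, ∃ g ∈ G, ‖g‖ ≤ 1 ∧ ‖y‖ / 2 ≤ ‖g y‖

/-- By compactness of the unit sphere of `F`, finitely many norming functionals are enough; `0` is
added to serve `y = 0`. -/
lemma exists_finite_isHalfNorming {𝕜 E : Type*} [RCLike 𝕜] [NormedAddCommGroup E]
    [NormedSpace 𝕜 E] (F : Submodule 𝕜 E) [FiniteDimensional 𝕜 F] :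
    ∃ G : Set (StrongDual 𝕜 E), G.Finite ∧ IsHalfNorming F G := by
  have : ProperSpace F := FiniteDimensional.proper_rclike 𝕜 F
  choose g hg1 hg2 using fun y : F => exists_dual_vector'' 𝕜 (y : E)
  obtain ⟨t, -, ht⟩ := (isCompact_sphere (0 : F) 1).elim_nhds_subcover
    (fun y => {w | 1 / 2 < ‖g y w‖}) (fun y hy => by
      have hc : Continuous fun w : F => ‖g y w‖ := by fun_prop
      refine (isOpen_lt continuous_const hc).mem_nhds ?_
      have : ‖(y : E)‖ = 1 := by simpa using hy
      simp only [Set.mem_ofPred_eq, hg2, this]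
      norm_num)
  refine ⟨insert 0 (g '' t), (t.finite_toSet.image g).insert 0, fun y hy => ?_⟩
  by_cases hy0 : y = 0
  · exact ⟨0, Set.mem_insert _ _, by simp, by simp [hy0]⟩
  have hn : ‖y‖ ≠ 0 := by simpa using hy0
  have hs : ((‖y‖ : 𝕜)⁻¹ • (⟨y, hy⟩ : F)) ∈ Metric.sphere (0 : F) 1 := by
    simp [norm_smul, hn]
  obtain ⟨w, hw, hwy⟩ := Set.mem_iUnion₂.1 (ht hs)
  refine ⟨g w, Set.mem_insert_of_mem _ ⟨w, hw, rfl⟩, hg1 w, ?_⟩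
  have h1 : 1 / 2 < ‖g w ((‖y‖ : 𝕜)⁻¹ • y)‖ := hwy
  rw [map_smul, norm_smul, norm_inv, RCLike.norm_ofReal, abs_norm] at h1
  have : 0 < ‖y‖ := by positivity
  rw [inv_mul_eq_div, lt_div_iff₀ this] at h1
  linarith

open Cardinal in
-- Each vector of the span lies in the span of finitely many `v b`; the union of finite sets over
-- all finite subsets of `B` stays below `κ`.
lemma exists_isHalfNorming_span {𝕜 : Type} {E B : Type u} [RCLike 𝕜] [NormedAddCommGroup E]
    [NormedSpace 𝕜 E] (v : B → E) {κ : Cardinal.{u}} (hκ : ℵ₀ ≤ κ) (hB : #B < κ) :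
    ∃ G : Set (StrongDual 𝕜 E), #G < κ ∧ IsHalfNorming (Submodule.span 𝕜 (Set.range v)) G := by
  classical
  choose G hGf hG using fun s : Finset B =>
    have : FiniteDimensional 𝕜 (Submodule.span 𝕜 (v '' (s : Set B))) :=
      FiniteDimensional.span_of_finite 𝕜 (s.finite_toSet.image v)
    exists_finite_isHalfNorming (𝕜 := 𝕜) (Submodule.span 𝕜 (v '' (s : Set B)))
  refine ⟨⋃ s, G s, ?_, fun y hy => ?_⟩
  · rcases finite_or_infinite B with hfin | hinf
    · refine lt_of_lt_of_le ?_ hκ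
      rw [lt_aleph0_iff_set_finite]
      exact Set.finite_iUnion hGf
    · refine (mk_iUnion_le _).trans_lt ?_
      rw [mk_finset_of_infinite]
      have h1 : ⨆ s, #(G s) ≤ ℵ₀ :=
        ciSup_le' fun s => (lt_aleph0_iff_set_finite.2 (hGf s)).le
      calc #B * ⨆ s, #(G s) ≤ #B * ℵ₀ := mul_le_mul_right h1 _
        _ = #B := mul_aleph0_eq (aleph0_le_mk B)
        _ < κ := hB
  · obtain ⟨T, hT, hyT⟩ := Submodule.mem_span_finite_of_mem_span hy
    rw [← Set.image_univ, Finset.subset_set_image_iff] at hT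
    obtain ⟨s, -, rfl⟩ := hT
    rw [Finset.coe_image] at hyT
    obtain ⟨g, hg, h⟩ := hG s y hyT
    exact ⟨g, Set.mem_iUnion.2 ⟨s, hg⟩, h⟩

open Cardinal in
/-- One step of the construction of a bounded biorthogonal system. -/
lemma exists_biorthogonal_step {𝕜 : Type} {E B : Type u} [RCLike 𝕜] [NormedAddCommGroup E]
    [NormedSpace 𝕜 E] {κ : Cardinal.{u}} (hκ : ℵ₀ ≤ κ)
    (htot : ∀ S : Set (StrongDual 𝕜 E), IsTotalSet S → κ ≤ #S) (hB : #B < κ)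
    (v : B → E) (w : B → StrongDual 𝕜 E) :
    ∃ (x : E) (f : StrongDual 𝕜 E), ‖x‖ = 1 ∧ ‖f‖ ≤ 3 ∧ f x = 1 ∧ (∀ b, w b x = 0) ∧
      ∀ b, f (v b) = 0 := by
  obtain ⟨G, hGκ, hG⟩ := exists_isHalfNorming_span (𝕜 := 𝕜) v hκ hB
  have hcard : #(G ∪ Set.range w : Set (StrongDual 𝕜 E)) < κ :=
    (mk_union_le _ _).trans_lt (add_lt_of_lt hκ hGκ (mk_range_le.trans_lt hB))
  obtain ⟨z, hz, hz0⟩ : ∃ z, (∀ g ∈ G ∪ Set.range w, g z = 0) ∧ z ≠ 0 := by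
    by_contra! h
    exact absurd (htot _ h) (not_le.2 hcard)
  set x : E := ((‖z‖ : 𝕜)⁻¹) • z with hx
  have hx1 : ‖x‖ = 1 := norm_smul_inv_norm hz0
  have hxg : ∀ g ∈ G ∪ Set.range w, g x = 0 := fun g hg => by rw [hx, map_smul, hz g hg, smul_zero]
  set F := Submodule.span 𝕜 (Set.range v)
  -- For `y ∈ F` and a half-norming `g` killing `x`, `‖x - y‖` is at least `‖y‖ / 2`, and `‖y‖ ≥ 1 -
  -- ‖x - y‖`.
  have hq : 1 / 3 ≤ ‖F.mkQL x‖ := by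
    change 1 / 3 ≤ ‖(QuotientAddGroup.mk x : E ⧸ F.toAddSubgroup)‖
    rw [QuotientAddGroup.norm_mk]
    refine (Metric.le_infDist ⟨0, F.zero_mem⟩).2 ?_
    intro y hy
    obtain ⟨g, hg, hg1, hgy⟩ := hG y hy
    have h1 : ‖g (x - y)‖ ≤ ‖x - y‖ := by
      simpa using g.le_of_opNorm_le hg1 (x - y)
    rw [map_sub, hxg g (Or.inl hg), zero_sub, norm_neg] at h1
    have h2 := norm_sub_norm_le x y
    rw [dist_eq_norm]
    linarith
  have hq0 : ‖F.mkQL x‖ ≠ 0 := by linarith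
  obtain ⟨g, hg1, hgx⟩ := exists_dual_vector 𝕜 (F.mkQL x) hq0
  refine ⟨x, ((‖F.mkQL x‖ : 𝕜)⁻¹) • g.comp F.mkQL, hx1, ?_, ?_, fun b => hxg _ (Or.inr ⟨b, rfl⟩),
    fun b => ?_⟩
  · refine ContinuousLinearMap.opNorm_le_bound _ (by norm_num) fun y => ?_
    have h1 : ‖g (F.mkQL y)‖ ≤ ‖y‖ := by
      refine (g.le_opNorm _).trans ?_
      rw [hg1, one_mul]
      exact Submodule.Quotient.norm_mk_le F y
    have h2 : ‖F.mkQL x‖⁻¹ ≤ 3 := by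
      rw [inv_le_comm₀ (by positivity) (by norm_num)]; linarith
    rw [smul_apply, norm_smul, norm_inv, RCLike.norm_ofReal, abs_norm]
    exact mul_le_mul h2 h1 (norm_nonneg _) (by norm_num)
  · have : (‖F.mkQL x‖ : 𝕜) ≠ 0 := by exact_mod_cast hq0
    rw [smul_apply, ContinuousLinearMap.comp_apply, hgx, smul_eq_mul, inv_mul_cancel₀ this]
  · have : F.mkQL (v b) = 0 :=
      (Submodule.Quotient.mk_eq_zero F).2 (Submodule.subset_span ⟨b, rfl⟩)
    rw [smul_apply, ContinuousLinearMap.comp_apply, this, map_zero, smul_zero]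

lemma exists_wellFounded_recursion {A β : Type*} [Preorder A] [WellFoundedLT A]
    (R : ∀ a : A, (Set.Iio a → β) → β → Prop) (h : ∀ a g, ∃ y, R a g y) :
    ∃ F : A → β, ∀ a, R a (fun b => F b) (F a) := by
  choose y hy using h
  refine ⟨WellFounded.fix (wellFounded_lt (α := A)) fun a F => y a fun b => F b b.2, fun a => ?_⟩
  rw [WellFounded.fix_eq]
  exact hy a _

open Cardinal in
lemma exists_minimal_isTotalSet {𝕜 : Type} {E : Type u} [RCLike 𝕜] [NormedAddCommGroup E]
    [NormedSpace 𝕜 E] :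
    ∃ S : Set (StrongDual 𝕜 E), IsTotalSet S ∧
      ∀ S' : Set (StrongDual 𝕜 E), IsTotalSet S' → #S ≤ #S' := by
  have huniv : IsTotalSet (Set.univ : Set (StrongDual 𝕜 E)) := fun z hz =>
    SeparatingDual.eq_zero_of_forall_dual_eq_zero (R := 𝕜) fun g => hz g trivial
  have hne : {c | ∃ S : Set (StrongDual 𝕜 E), IsTotalSet S ∧ #S = c}.Nonempty := ⟨_, _, huniv, rfl⟩
  obtain ⟨S, hS, hSc⟩ := csInf_mem hne
  exact ⟨S, hS, fun S' hS' => hSc ▸ csInf_le' ⟨S', hS', rfl⟩⟩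

lemma finiteDimensional_of_finite_isTotalSet {𝕜 E : Type*} [RCLike 𝕜] [NormedAddCommGroup E]
    [NormedSpace 𝕜 E] {S : Set (StrongDual 𝕜 E)} (hS : IsTotalSet S) (hf : S.Finite) :
    FiniteDimensional 𝕜 E := by
  have := hf.to_subtype
  let e : E →ₗ[𝕜] (S → 𝕜) := LinearMap.pi fun g => (g : StrongDual 𝕜 E).toLinearMap
  refine Module.Finite.of_injective e ((injective_iff_map_eq_zero e).2 fun z hz => ?_)
  exact hS z fun g hg => congrFun hz ⟨g, hg⟩

/-- Bounded biorthogonal systems, indexed by a well-ordered set, with a bounded family of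
functionals, zero at the two greatest elements, which is total together with the system. -/
structure TotalBiorthogonal (𝕜 E A : Type*) [RCLike 𝕜] [NormedAddCommGroup E] [NormedSpace 𝕜 E]
    [LinearOrder A] where
  x : A → E
  f : A → StrongDual 𝕜 E
  h : A → StrongDual 𝕜 E
  bound : ℝ
  x_le : ∀ a, ‖x a‖ ≤ bound
  f_le : ∀ a, ‖f a‖ ≤ bound
  h_le : ∀ a, ‖h a‖ ≤ bound
  f_x : ∀ a b, f a (x b) = if a = b then 1 else 0
  h_eq_zero : ∀ a, h a = 0 ∨ ∃ b c, a < b ∧ b < c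
  total : ∀ z, (∀ a, f a z = 0) → (∀ a, h a z = 0) → z = 0

open Cardinal in
-- Indexing by the initial ordinal of the least size of a total set makes each stage have too few
-- predecessors for totality, so the recursion continues. The same ordinal enumerates a total set as
-- `h`, and having no maximum gives two chords above each index.
lemma exists_totalBiorthogonal_of_infinite (𝕜 : Type) (E : Type u) [RCLike 𝕜]
    [NormedAddCommGroup E] [NormedSpace 𝕜 E] (hE : ¬ FiniteDimensional 𝕜 E) :
    ∃ (A : Type u) (_ : LinearOrder A), WellFoundedLT A ∧ Nontrivial A ∧
      Nonempty (TotalBiorthogonal 𝕜 E A) := by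
  obtain ⟨S, hS, hmin⟩ := exists_minimal_isTotalSet (𝕜 := 𝕜) (E := E)
  have hκ : ℵ₀ ≤ #S := by
    by_contra! h
    exact hE (finiteDimensional_of_finite_isTotalSet hS (lt_aleph0_iff_set_finite.1 h))
  let A := (#S).ord.ToType
  have hA : #A = #S := mk_ord_toType _
  have : NoMaxOrder A := Cardinal.noMaxOrder hκ
  have : Infinite A := by rw [Cardinal.infinite_iff, hA]; exact hκ
  obtain ⟨e⟩ := Cardinal.eq.1 hA
  obtain ⟨F, hF⟩ := exists_wellFounded_recursion (A := A) (β := E × StrongDual 𝕜 E)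
    (fun a g y => ‖y.1‖ = 1 ∧ ‖y.2‖ ≤ 3 ∧ y.2 y.1 = 1 ∧ (∀ b, (g b).2 y.1 = 0) ∧
      ∀ b, y.2 (g b).1 = 0)
    (fun a g => by
      obtain ⟨x, f, h⟩ := exists_biorthogonal_step (𝕜 := 𝕜) hκ hmin
        (B := Set.Iio a) (by simpa [hA] using mk_Iio_lt a (by simp [A]))
        (fun b => (g b).1) (fun b => (g b).2)
      exact ⟨(x, f), h⟩)
  refine ⟨A, inferInstance, inferInstance, inferInstance, ⟨{
    x := fun a => (F a).1
    f := fun a => (F a).2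
    h := fun a => ((‖(e a : StrongDual 𝕜 E)‖ + 1 : ℝ) : 𝕜)⁻¹ • (e a : StrongDual 𝕜 E)
    bound := 3
    x_le := fun a => by rw [(hF a).1]; norm_num
    f_le := fun a => (hF a).2.1
    h_le := fun a => ?_
    f_x := fun a b => ?_
    h_eq_zero := fun a => ?_
    total := fun z _ hz => hS z fun g hg => ?_ }⟩⟩
  · have hp : 0 < ‖(e a : StrongDual 𝕜 E)‖ + 1 := by positivity
    rw [norm_smul, norm_inv, RCLike.norm_ofReal, abs_of_pos hp, inv_mul_le_iff₀ hp]
    linarith [norm_nonneg (e a : StrongDual 𝕜 E)]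
  · rcases lt_trichotomy a b with h | rfl | h
    · rw [if_neg h.ne]
      exact (hF b).2.2.2.1 ⟨a, h⟩
    · rw [if_pos rfl]
      exact (hF a).2.2.1
    · rw [if_neg h.ne']
      exact (hF a).2.2.2.2 ⟨b, h⟩
  · obtain ⟨b, hb⟩ := exists_gt a
    obtain ⟨c, hc⟩ := exists_gt b
    exact Or.inr ⟨b, c, hb, hc⟩
  · have h1 := hz (e.symm ⟨g, hg⟩)
    have hp : ((‖g‖ + 1 : ℝ) : 𝕜) ≠ 0 := by
      have : ‖g‖ + 1 ≠ 0 := by positivity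
      exact_mod_cast this
    simpa [hp, -map_add] using h1

/-- Coordinates in a basis are already total, so `h = 0` is allowed; the largest indices lack the
chords that would control `h`. -/
lemma exists_totalBiorthogonal_of_finite (𝕜 : Type) (E : Type u) [RCLike 𝕜]
    [NormedAddCommGroup E] [NormedSpace 𝕜 E] [FiniteDimensional 𝕜 E]
    (hE : 2 ≤ Module.rank 𝕜 E) :
    ∃ (A : Type u) (_ : LinearOrder A), WellFoundedLT A ∧ Nontrivial A ∧
      Nonempty (TotalBiorthogonal 𝕜 E A) := by
  let b := Module.Basis.ofVectorSpace 𝕜 E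
  set A := Module.Basis.ofVectorSpaceIndex 𝕜 E
  have : Fintype A := FiniteDimensional.fintypeBasisIndex b
  obtain ⟨lin, wf⟩ := exists_wellFoundedLT A
  have hnt : Nontrivial A := by
    rw [← Cardinal.one_lt_iff_nontrivial, b.mk_eq_rank'']
    exact lt_of_lt_of_le (by norm_num) hE
  let f : A → StrongDual 𝕜 E := fun a => LinearMap.toContinuousLinearMap (b.coord a)
  refine ⟨A, lin, wf, hnt, ⟨{
    x := b
    f := f
    h := 0
    bound := ∑ a, (‖b a‖ + ‖f a‖)
    x_le := fun a => ?_
    f_le := fun a => ?_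
    h_le := fun a => ?_
    f_x := fun a c => ?_
    h_eq_zero := fun a => Or.inl rfl
    total := fun z hz _ => ?_ }⟩⟩
  · refine le_trans ?_ (Finset.single_le_sum (f := fun a => ‖b a‖ + ‖f a‖)
      (fun _ _ => by positivity) (Finset.mem_univ a))
    simp
  · refine le_trans ?_ (Finset.single_le_sum (f := fun a => ‖b a‖ + ‖f a‖)
      (fun _ _ => by positivity) (Finset.mem_univ a))
    simp
  · simp only [Pi.zero_apply, norm_zero]
    positivity
  · simp [f, Finsupp.single_apply, eq_comm]
  · exact b.forall_coord_eq_zero_iff.1 hz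

lemma exists_totalBiorthogonal (𝕜 : Type) (E : Type u) [RCLike 𝕜]
    [NormedAddCommGroup E] [NormedSpace 𝕜 E] (hE : 2 ≤ Module.rank 𝕜 E) :
    ∃ (A : Type u) (_ : LinearOrder A), WellFoundedLT A ∧ Nontrivial A ∧
      Nonempty (TotalBiorthogonal 𝕜 E A) := by
  by_cases h : FiniteDimensional 𝕜 E
  · exact exists_totalBiorthogonal_of_finite 𝕜 E hE
  · exact exists_totalBiorthogonal_of_infinite 𝕜 E h

/-! ### Norms with only trivial real isometries -/

/-- If the functionals of the renorming separate points, its isometries are multiples of the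
identity, or of a conjugation compatible with the data. -/
lemma SpikeData.eq_smul_of_isRealIsometry {X A : Type*} [NormedAddCommGroup X] [NormedSpace ℂ X]
    [LinearOrder A] [WellFoundedLT A] [Nontrivial A] (D : SpikeData X A)
    (htop : ∀ a, D.h a = 0 ∨ ∃ b c, a < b ∧ b < c)
    (hsep : ∀ z, (∀ a, D.f a z = 0) → (∀ a, D.h a z = 0) → z = 0)
    {T : X ≃ₗ[ℝ] X} (hT : IsRealIsometry D.N T) :
    IsTrivialMap T ∨ D.ω = 1 ∧ ∀ c : X → X,
      (∀ a z, D.f a (c z) = (starRingEnd ℂ) (D.f a z)) →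
      (∀ a z, D.h a (c z) = (starRingEnd ℂ) (D.h a z)) →
      ∃ μ : ℂ, ‖μ‖ = 1 ∧ ∀ z, T z = μ • c z := by
  obtain ⟨μ, hμ, ⟨hf, hh⟩ | ⟨hω, hf, hh⟩⟩ := D.exists_comp_of_isRealIsometry hT htop
  · refine Or.inl ⟨μ, hμ, fun z => sub_eq_zero.1 (hsep _ (fun a => ?_) fun a => ?_)⟩
    · rw [map_sub, hf, map_smul, smul_eq_mul, sub_self]
    · rw [map_sub, hh, map_smul, smul_eq_mul, sub_self]
  · refine Or.inr ⟨hω, fun c hfc hhc => ⟨μ, hμ, fun z => sub_eq_zero.1 (hsep _ (fun a => ?_)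
      fun a => ?_)⟩⟩
    · rw [map_sub, hf, map_smul, smul_eq_mul, hfc, sub_self]
    · rw [map_sub, hh, map_smul, smul_eq_mul, hhc, sub_self]

lemma isRealIsometry_of_isTrivialMap {X : Type*} [NormedAddCommGroup X] [NormedSpace ℂ X]
    (N : Seminorm ℂ X) {T : X ≃ₗ[ℝ] X} (hT : IsTrivialMap T) : IsRealIsometry N T := by
  obtain ⟨μ, hμ, h⟩ := hT
  intro z
  rw [h, map_smul_eq_mul, hμ, one_mul]

/-- Choosing `ω = i` excludes the conjugate-linear alternative. -/
theorem exists_norm_isRealIsometry_iff_isTrivialMap (X : Type u) [NormedAddCommGroup X]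
    [NormedSpace ℂ X] (hX : 2 ≤ Module.rank ℂ X) :
    ∃ N : Seminorm ℂ X, IsEquivalentNorm N ∧
      ∀ T : X ≃ₗ[ℝ] X, IsRealIsometry N T ↔ IsTrivialMap T := by
  obtain ⟨A, _, _, _, ⟨B⟩⟩ := exists_totalBiorthogonal ℂ X hX
  have hp : IsEquivalentNorm (normSeminorm ℂ X) := ⟨1, 1, one_pos, one_pos, fun x => by simp⟩
  obtain ⟨D, hDf, hDω, ⟨ε, hε, hDh⟩, -⟩ :=
    exists_spikeData B.x B.f B.h B.x_le B.f_le B.h_le B.f_x (Or.inr rfl) hp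
  refine ⟨D.N, D.isEquivalentNorm_N, fun T =>
    ⟨fun hT => ?_, isRealIsometry_of_isTrivialMap _⟩⟩
  refine (D.eq_smul_of_isRealIsometry (fun a => ?_) (fun z hz hz' => ?_) hT).resolve_right
    fun h => ?_
  · refine (B.h_eq_zero a).imp_left fun h => ?_
    rw [hDh, h]
    ext z
    simp
  · refine B.total z (fun a => ?_) fun a => ?_
    · rw [← hDf]; exact hz a
    · have := hz' a
      rw [hDh] at this
      simpa [hε] using this
  · have := hDω ▸ h.1
    simpa using congrArg Complex.im this

/-! ### Canonical complex structures -/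

namespace CanonicalSquare

variable {X : Type u} {Y : Type v} [NormedAddCommGroup X] [NormedSpace ℂ X]
  [NormedAddCommGroup Y] [NormedSpace ℝ Y] (S : CanonicalSquare X Y)

lemma equiv_smul (μ : ℂ) (z : X) : S.equiv (μ • z) =
    (μ.re • (S.equiv z).1 - μ.im • (S.equiv z).2, μ.re • (S.equiv z).2 + μ.im • (S.equiv z).1) := by
  have h : μ • z = μ.re • z + μ.im • (Complex.I • z) := by
    conv_lhs => rw [← Complex.re_add_im μ, add_smul, mul_smul]
    simp only [Complex.coe_smul]
  rw [h, map_add, map_smul, map_smul, S.equiv_I_smul]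
  ext <;> simp [sub_eq_add_neg]

lemma equiv_conj (z : X) : S.equiv (S.conj z) = ((S.equiv z).1, -(S.equiv z).2) := by
  simp [conj]

lemma conj_conj (z : X) : S.conj (S.conj z) = z := by
  apply S.equiv.injective
  rw [equiv_conj, equiv_conj, neg_neg]

lemma conj_add (z w : X) : S.conj (z + w) = S.conj z + S.conj w := by
  apply S.equiv.injective
  rw [map_add, equiv_conj, equiv_conj, equiv_conj, map_add]
  ext <;> simp [add_comm]

lemma conj_smul (μ : ℂ) (z : X) : S.conj (μ • z) = (starRingEnd ℂ μ) • S.conj z := by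
  apply S.equiv.injective
  rw [equiv_smul, equiv_conj, equiv_conj, equiv_smul]
  ext <;> simp [sub_eq_add_neg, add_comm]

lemma exists_norm_conj_le : ∃ C : ℝ, 0 ≤ C ∧ ∀ z, ‖S.conj z‖ ≤ C * ‖z‖ := by
  refine ⟨‖(S.equiv.symm : Y × Y →L[ℝ] X)‖ * ‖(S.equiv : X →L[ℝ] Y × Y)‖, by positivity,
    fun z => ?_⟩
  have h1 := (S.equiv.symm : Y × Y →L[ℝ] X).le_opNorm ((S.equiv z).1, -(S.equiv z).2)
  have h2 : ‖((S.equiv z).1, -(S.equiv z).2)‖ = ‖S.equiv z‖ := by simp [Prod.norm_def]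
  have h3 := (S.equiv : X →L[ℝ] Y × Y).le_opNorm z
  rw [h2] at h1
  rw [mul_assoc]
  exact h1.trans (by gcongr; exact h3)

/-- A conjugation-invariant equivalent norm. -/
noncomputable def symmSeminorm : Seminorm ℂ X :=
  Seminorm.of (fun z => ‖z‖ + ‖S.conj z‖)
    (fun z w => by
      rw [conj_add]
      linarith [norm_add_le z w, norm_add_le (S.conj z) (S.conj w)])
    (fun μ z => by
      rw [conj_smul, norm_smul, norm_smul, RCLike.norm_conj, mul_add])

lemma symmSeminorm_apply (z : X) : S.symmSeminorm z = ‖z‖ + ‖S.conj z‖ := rfl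

lemma symmSeminorm_conj (z : X) : S.symmSeminorm (S.conj z) = S.symmSeminorm z := by
  rw [symmSeminorm_apply, symmSeminorm_apply, conj_conj, add_comm]

lemma isEquivalentNorm_symmSeminorm : IsEquivalentNorm S.symmSeminorm := by
  obtain ⟨C, hC, h⟩ := S.exists_norm_conj_le
  refine ⟨1, 1 + C, one_pos, by positivity, fun z => ?_⟩
  rw [symmSeminorm_apply]
  constructor <;> linarith [h z, norm_nonneg (S.conj z)]

/-- The complexification of a real functional. -/
noncomputable def complexify (φ : StrongDual ℝ Y) : X →L[ℂ] ℂ :=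
  StrongDual.extendRCLike (𝕜 := ℂ)
    ((φ.comp (ContinuousLinearMap.fst ℝ Y Y)).comp (S.equiv : X →L[ℝ] Y × Y))

lemma complexify_apply (φ : StrongDual ℝ Y) (z : X) :
    S.complexify φ z = φ (S.equiv z).1 + Complex.I * φ (S.equiv z).2 := by
  rw [complexify, StrongDual.extendRCLike_apply]
  simp [S.equiv_I_smul]

lemma complexify_conj (φ : StrongDual ℝ Y) (z : X) :
    S.complexify φ (S.conj z) = (starRingEnd ℂ) (S.complexify φ z) := by
  rw [complexify_apply, complexify_apply, equiv_conj]
  simp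

lemma complexify_eq_zero_iff (φ : StrongDual ℝ Y) (z : X) :
    S.complexify φ z = 0 ↔ φ (S.equiv z).1 = 0 ∧ φ (S.equiv z).2 = 0 := by
  rw [complexify_apply, Complex.ext_iff]
  simp

lemma norm_complexify_le (φ : StrongDual ℝ Y) :
    ‖S.complexify φ‖ ≤ 2 * ‖φ‖ * ‖(S.equiv : X →L[ℝ] Y × Y)‖ := by
  refine ContinuousLinearMap.opNorm_le_bound _ (by positivity) fun z => ?_
  rw [complexify_apply]
  refine (norm_add_le _ _).trans ?_
  rw [norm_mul, Complex.norm_I, one_mul, Complex.norm_real, Complex.norm_real]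
  have h1 := (S.equiv : X →L[ℝ] Y × Y).le_opNorm z
  rw [ContinuousLinearEquiv.coe_coe] at h1
  have h2 : ‖φ (S.equiv z).1‖ ≤ ‖φ‖ * (‖(S.equiv : X →L[ℝ] Y × Y)‖ * ‖z‖) :=
    (φ.le_opNorm _).trans (by gcongr; exact (norm_fst_le _).trans h1)
  have h3 : ‖φ (S.equiv z).2‖ ≤ ‖φ‖ * (‖(S.equiv : X →L[ℝ] Y × Y)‖ * ‖z‖) :=
    (φ.le_opNorm _).trans (by gcongr; exact (norm_snd_le _).trans h1)
  linarith

lemma isRealIsometry_of_isConjugationMap {N : Seminorm ℂ X} (hN : ∀ z, N (S.conj z) = N z)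
    {T : X ≃ₗ[ℝ] X} (hT : S.IsConjugationMap T) : IsRealIsometry N T := by
  obtain ⟨μ, hμ, h⟩ := hT
  intro z
  rw [h, map_smul_eq_mul, hμ, one_mul, hN]

/-- Complexified functionals intertwine `c` with complex conjugation and the base norm is
symmetrised, so with `ω = 1` the renorming is invariant under `c`. Totality on `Y` passes to both
components of `X`. -/
theorem exists_norm_of_two_le_rank (hY : 2 ≤ Module.rank ℝ Y) :
    ∃ N : Seminorm ℂ X, IsEquivalentNorm N ∧
      ∀ T : X ≃ₗ[ℝ] X, IsRealIsometry N T ↔ (IsTrivialMap T ∨ S.IsConjugationMap T) := by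
  obtain ⟨A, _, _, _, ⟨B⟩⟩ := exists_totalBiorthogonal ℝ Y hY
  set s := ‖(S.equiv : X →L[ℝ] Y × Y)‖
  set s' := ‖(S.equiv.symm : Y × Y →L[ℝ] X)‖
  have hB0 : 0 ≤ B.bound := by
    obtain ⟨a⟩ := (inferInstance : Nonempty A)
    exact (norm_nonneg _).trans (B.x_le a)
  have hc : ∀ φ : StrongDual ℝ Y, ‖φ‖ ≤ B.bound →
      ‖S.complexify φ‖ ≤ 2 * B.bound * s + s' * B.bound :=
    fun φ hφ => (S.norm_complexify_le φ).trans <| by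
      have h1 : 2 * ‖φ‖ * s ≤ 2 * B.bound * s := by gcongr
      have h2 : 0 ≤ s' * B.bound := by positivity
      linarith
  obtain ⟨D, hDf, hDω, ⟨ε, hε, hDh⟩, hq⟩ :=
    exists_spikeData (fun a => S.equiv.symm (B.x a, 0)) (fun a => S.complexify (B.f a))
      (fun a => S.complexify (B.h a)) (M := 2 * B.bound * s + s' * B.bound)
      (fun a => by
        have h1 : ‖S.equiv.symm (B.x a, 0)‖ ≤ s' * ‖(B.x a, (0 : Y))‖ :=
          (S.equiv.symm : Y × Y →L[ℝ] X).le_opNorm _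
        have h2 : ‖(B.x a, (0 : Y))‖ = ‖B.x a‖ := by simp [Prod.norm_def]
        rw [h2] at h1
        have h3 : s' * ‖B.x a‖ ≤ s' * B.bound := by gcongr; exact B.x_le a
        have h4 : 0 ≤ 2 * B.bound * s := by positivity
        linarith)
      (fun a => hc _ (B.f_le a)) (fun a => hc _ (B.h_le a))
      (fun a b => by
        rw [complexify_apply, S.equiv.apply_symm_apply, B.f_x]
        split_ifs <;> simp) (Or.inl rfl) S.isEquivalentNorm_symmSeminorm
  have hfc : ∀ a z, D.f a (S.conj z) = (starRingEnd ℂ) (D.f a z) := fun a z => by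
    rw [hDf, complexify_conj]
  have hhc : ∀ a z, D.h a (S.conj z) = (starRingEnd ℂ) (D.h a z) := fun a z => by
    rw [hDh]
    simp [complexify_conj]
  have hN : ∀ z, D.N (S.conj z) = D.N z :=
    D.N_comp_conj hDω (fun z => hq _ _ (S.symmSeminorm_conj z) fun a => by
      rw [complexify_conj, RCLike.norm_conj]) hfc hhc
  refine ⟨D.N, D.isEquivalentNorm_N, fun T => ⟨fun hT => ?_, ?_⟩⟩
  · refine (D.eq_smul_of_isRealIsometry (fun a => ?_) (fun z hz hz' => ?_) hT).imp_right
      fun h => h.2 _ hfc hhc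
    · refine (B.h_eq_zero a).imp_left fun h => ?_
      rw [hDh, h]
      ext z
      simp [complexify_apply]
    · have h1 : ∀ a, B.f a (S.equiv z).1 = 0 ∧ B.f a (S.equiv z).2 = 0 := fun a => by
        rw [← complexify_eq_zero_iff]
        have := hz a
        rwa [hDf] at this
      have h2 : ∀ a, B.h a (S.equiv z).1 = 0 ∧ B.h a (S.equiv z).2 = 0 := fun a => by
        rw [← complexify_eq_zero_iff]
        have := hz' a
        rw [hDh] at this
        simpa [hε] using this
      apply S.equiv.injective
      rw [map_zero]
      exact Prod.ext (B.total _ (fun a => (h1 a).1) fun a => (h2 a).1)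
        (B.total _ (fun a => (h1 a).2) fun a => (h2 a).2)
  · rintro (hT | hT)
    · exact isRealIsometry_of_isTrivialMap _ hT
    · exact S.isRealIsometry_of_isConjugationMap hN hT

/-- In (complex) dimension at most one, the modulus of an injective functional is a norm whose
isometries are the multiples of the identity and of the conjugation. -/
theorem exists_norm_of_rank_lt_two (hY : Module.rank ℝ Y < 2) :
    ∃ N : Seminorm ℂ X, IsEquivalentNorm N ∧
      ∀ T : X ≃ₗ[ℝ] X, IsRealIsometry N T ↔ (IsTrivialMap T ∨ S.IsConjugationMap T) := by
  have : FiniteDimensional ℝ Y := Module.rank_lt_aleph0_iff.1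
    (hY.trans (Cardinal.natCast_lt_aleph0 (n := 2)))
  have hfr : Module.finrank ℝ Y ≤ Module.finrank ℝ ℝ := by
    rw [← Module.finrank_eq_rank, ← Nat.cast_ofNat (n := 2), Nat.cast_lt] at hY
    rw [Module.finrank_self]
    exact Nat.lt_succ_iff.1 hY
  -- Dimension at most one gives an injective real functional, whose complexification identifies `X`
  -- with a subspace of `ℂ`.
  obtain ⟨φ₀, hφ₀⟩ := finrank_le_iff_exists_linearMap.1 hfr
  let φ : StrongDual ℝ Y := LinearMap.toContinuousLinearMap φ₀
  have hφ : ∀ y, φ y = 0 → y = 0 := fun y hy => (injective_iff_map_eq_zero φ₀).1 hφ₀ y hy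
  have hinj : ∀ z, S.complexify φ z = 0 → z = 0 := fun z hz => by
    obtain ⟨h1, h2⟩ := (S.complexify_eq_zero_iff φ z).1 hz
    apply S.equiv.injective
    rw [map_zero]
    exact Prod.ext (hφ _ h1) (hφ _ h2)
  let N : Seminorm ℂ X := (normSeminorm ℂ ℂ).comp (S.complexify φ).toLinearMap
  have hN : ∀ z, N z = ‖S.complexify φ z‖ := fun z => rfl
  refine ⟨N, ?_, fun T => ⟨fun hT => ?_, ?_⟩⟩
  · have hinj' : Function.Injective (S.complexify φ).toLinearMap :=
      (injective_iff_map_eq_zero _).2 hinj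
    have : FiniteDimensional ℂ X := Module.Finite.of_injective _ hinj'
    obtain ⟨K, hK, hK'⟩ := (S.complexify φ).toLinearMap.exists_antilipschitzWith
      (LinearMap.ker_eq_bot.2 hinj')
    refine ⟨(K : ℝ)⁻¹, ‖S.complexify φ‖ + 1, by positivity, by positivity, fun z => ⟨?_, ?_⟩⟩
    · have := hK'.le_mul_dist z 0
      rw [map_zero, dist_zero_right, dist_zero_right] at this
      rw [inv_mul_le_iff₀ (by positivity)]
      exact this
    · rw [hN]
      exact ((S.complexify φ).le_opNorm z).trans (by gcongr; linarith)
  · obtain ⟨L, hL⟩ := exists_linearIsometry_of_norm_eq (S.complexify φ).toLinearMap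
      (((S.complexify φ).toLinearMap.restrictScalars ℝ) ∘ₗ T.toLinearMap) hT
    replace hL : ∀ z, S.complexify φ (T z) = L (S.complexify φ z) := hL
    obtain ⟨μ, hμ, h | h⟩ := L.exists_eq_mul
    · refine Or.inl ⟨μ, hμ, fun z => sub_eq_zero.1 (hinj _ ?_)⟩
      rw [map_sub, hL, h, map_smul, smul_eq_mul, sub_self]
    · refine Or.inr ⟨μ, hμ, fun z => sub_eq_zero.1 (hinj _ ?_)⟩
      rw [map_sub, hL, h, map_smul, smul_eq_mul, complexify_conj, sub_self]
  · rintro (hT | hT)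
    · exact isRealIsometry_of_isTrivialMap _ hT
    · exact S.isRealIsometry_of_isConjugationMap (fun z => by
        rw [hN, hN, complexify_conj, RCLike.norm_conj]) hT

end CanonicalSquare

/-! ### The main theorem -/

theorem corollary3p10 (X : Type*) [NormedAddCommGroup X] [NormedSpace ℂ X]
    [CompleteSpace X] :
    (2 ≤ Module.rank ℂ X →
      ∃ N : Seminorm ℂ X, IsEquivalentNorm N ∧
        ∀ T : X ≃ₗ[ℝ] X, IsRealIsometry N T ↔ IsTrivialMap T) ∧
    (∀ (Y : Type*) [NormedAddCommGroup Y] [NormedSpace ℝ Y] (S : CanonicalSquare X Y),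
      ∃ N : Seminorm ℂ X, IsEquivalentNorm N ∧
        ∀ T : X ≃ₗ[ℝ] X, IsRealIsometry N T ↔ (IsTrivialMap T ∨ S.IsConjugationMap T)) := by
  refine ⟨exists_norm_isRealIsometry_iff_isTrivialMap X, fun Y _ _ S => ?_⟩
  rcases lt_or_ge (Module.rank ℝ Y) 2 with h | h
  · exact S.exists_norm_of_rank_lt_two h
  · exact S.exists_norm_of_two_le_rank h
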